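/- All spaces are over $\mathbb{C}$. For a normed space $F$, $p\ge 1$ and $x=(x_1,\dots,x_n)\in F^n$, let $$\mu_{p,n}(x)=\sup\Big\{\Big(\sum_{i=1}^n|\langle x_i,\varphi\rangle|^p\Big)^{1/p}:\varphi\in F',\ \|\varphi\|\le 1\Big\}.$$ For a normed space $E$ and $1\le p\le q<\infty$, the $(p,q)$-multi-norm based on $E$ is the sequence of norms on the spaces $E^n$, $n\in\mathbb{N}$, given by $$\|(x_1,\dots,x_n)\|^{(p,q)}_n=\sup\Big\{\Big(\sum_{i=1}^n|\langle x_i,\lambda_i\rangle|^q\Big)^{1/q}:\lambda_1,\dots,\lambda_n\in E',\ \mu_{p,n}(\lambda_1,\dots,\lambda_n)\le 1\Big\},$$ and the minimum multi-norm is given by $\|(x_1,\dots,x_n)\|^{\min}_n=\max_i\|x_i\|$. Two multi-norms $(\|\cdot\|^1_n)$ and $(\|\cdot\|^2_n)$ based on $E$ are equivalent if there are constants $C,C'>0$ such that $\|x\|^1_n\le C\|x\|^2_n$ and $\|x\|^2_n\le C'\|x\|^1_n$ for all $n\in\mathbb{N}$ and $x\in E^n$. Points $(p_1,q_1)$ and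 $(p_2,q_2)$ of $\mathcal{T}=\{(p,q)\in\mathbb{R}^2:1\le p\le q\}$ are equivalent on $E$ if the $(p_1,q_1)$- and $(p_2,q_2)$-multi-norms based on $E$ are equivalent. For $c\in[0,1)$ set $\mathcal{C}_c=\{(p,q)\in\mathcal{T}:1/p-1/q=c\}$. Let $1<r<\infty$ and $\bar r=\min\{2,r\}$. Define the curves $\mathcal{D}_c$ $(0\le c<1)$ as follows. * If $c\in[1/\bar r,1)$, then $\mathcal{D}_c=\mathcal{C}_c$. * If $c\in[0,1/r)$, then $\mathcal{D}_c=\{(p,q)\in\mathcal{C}_c:p\in[1,r]\}\cup\{(p,u_c):p\in[r,u_c]\}$, where $u_c=r/(1-cr)$. * If $r>2$ and $c\in[1/r,1/2)$, then $\mathcal{D}_c=\{(p,q)\in\mathcal{C}_c:p\in[1,2]\}\cup\{(p,v_c):p\in[2,w_c]\}$, where $v_c=2/(1-2c)$ and $w_c=rv_c/(r+v_c)$ (so that $(w_c,v_c)\in\mathcal{C}_{1/r}$). **Theorem.** Let $r>1$ and let $(\Omega,\mu)$ be a measure space such that $L^r(\Omega,\mu)$ is infinite-dimensional. Let $c_1,c_2\in[0,1)$,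 $P_1\in\mathcal{D}_{c_1}$ and $P_2\in\mathcal{D}_{c_2}$. 1. If $c_1,c_2\in[1/\bar r,1)$, then $P_1$ and $P_2$ are equivalent on $L^r(\Omega,\mu)$, and the corresponding $(p,q)$-multi-norms are equivalent to the minimum multi-norm. 2. If $c_1\in[1/\bar r,1)$ and $c_2\in[0,1/\bar r)$, then $P_1$ and $P_2$ are not equivalent on $L^r(\Omega,\mu)$. 3. If $c_1,c_2\in[0,1/\bar r)$ and $c_1\ne c_2$, then $P_1$ and $P_2$ are not equivalent on $L^r(\Omega,\mu)$. -/

import Mathlib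

open MeasureTheory

noncomputable section

namespace MultiNormed

/-- The weak `p`-summing norm `μ_{p,n}(x)` of a tuple `x = (x₁, …, xₙ)` in a complex normed space `F`:
the supremum of `(∑ |⟨xᵢ, φ⟩|ᵖ)^{1/p}` over the closed unit ball of the dual of `F`. -/
def weakSummingNorm {F : Type*} [NormedAddCommGroup F] [NormedSpace ℂ F]
    (p : ℝ) {n : ℕ} (x : Fin n → F) : ℝ :=
  sSup {t : ℝ | ∃ φ : StrongDual ℂ F, ‖φ‖ ≤ 1 ∧ t = (∑ i, ‖φ (x i)‖ ^ p) ^ (1 / p)}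

/-- The `(p,q)`-multi-norm of a tuple `x = (x₁, …, xₙ)` in `E`: the supremum of
`(∑ |⟨xᵢ, lᵢ⟩|^q)^{1/q}` over all tuples `l` in the dual of `E` with `μ_{p,n}(l) ≤ 1`. -/
def pqNorm {E : Type*} [NormedAddCommGroup E] [NormedSpace ℂ E]
    (p q : ℝ) (n : ℕ) (x : Fin n → E) : ℝ :=
  sSup {t : ℝ | ∃ l : Fin n → StrongDual ℂ E, weakSummingNorm p l ≤ 1 ∧
    t = (∑ i, ‖l i (x i)‖ ^ q) ^ (1 / q)}

/-- The minimum multi-norm: `max ‖xᵢ‖`. -/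
def minNorm {E : Type*} [NormedAddCommGroup E] (n : ℕ) (x : Fin n → E) : ℝ :=
  ⨆ i, ‖x i‖

/-- `N₂` dominates `N₁`: there is one constant that serves for all `n` and all `n`-tuples.
(The case `n = 0` is `0 ≤ C * 0` for the families above.) -/
def Dominates {E : Type*} (N₂ N₁ : ∀ n : ℕ, (Fin n → E) → ℝ) : Prop :=
  ∃ C : ℝ, 0 < C ∧ ∀ (n : ℕ) (x : Fin n → E), N₁ n x ≤ C * N₂ n x

/-- Two multi-norms based on `E` are equivalent if each dominates the other. -/
def Equivalent {E : Type*} (N₁ N₂ : ∀ n : ℕ, (Fin n → E) → ℝ) : Prop :=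
  Dominates N₁ N₂ ∧ Dominates N₂ N₁

/-- The points `P₁ = (p₁,q₁)` and `P₂ = (p₂,q₂)` are equivalent on `E`. -/
def PointsEquivalent (E : Type*) [NormedAddCommGroup E] [NormedSpace ℂ E] (P₁ P₂ : ℝ × ℝ) : Prop :=
  Equivalent (pqNorm (E := E) P₁.1 P₁.2) (pqNorm (E := E) P₂.1 P₂.2)

/-- The `(p,q)`-multi-norm for `P = (p,q)` is equivalent on `E` to the minimum multi-norm. -/
def EquivalentToMin (E : Type*) [NormedAddCommGroup E] [NormedSpace ℂ E] (P : ℝ × ℝ) : Prop :=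
  Equivalent (pqNorm (E := E) P.1 P.2) (minNorm (E := E))

/-- The extended triangle `{(p,q) : 1 ≤ p ≤ q}`. -/
def triangle : Set (ℝ × ℝ) := {P | 1 ≤ P.1 ∧ P.1 ≤ P.2}

/-- The curve `𝒞_c`. -/
def curveC (c : ℝ) : Set (ℝ × ℝ) := {P | P ∈ triangle ∧ 1 / P.1 - 1 / P.2 = c}

/-- `r̄ = min {2, r}`. -/
def rBar (r : ℝ) : ℝ := min 2 r

/-- `u_c`: the curve `𝒞_c` meets the line `p = r` at `(r, u_c)`. -/
def uCoord (r c : ℝ) : ℝ := r / (1 - c * r)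

/-- `v_c`: the curve `𝒞_c` meets the line `p = 2` at `(2, v_c)`. -/
def vCoord (c : ℝ) : ℝ := 2 / (1 - 2 * c)

/-- `w_c`: the line `q = v_c` meets the curve `𝒞_{1/r}` at `(w_c, v_c)`. -/
def wCoord (r c : ℝ) : ℝ := r * vCoord c / (r + vCoord c)

/-- The curve `𝒟_c` (for `r > 1` and `0 ≤ c < 1`), which depends on `r`. In the last case
`1/r ≤ c < 1/r̄`, and so `r > 2` and `r̄ = 2`. -/
def curveD (r c : ℝ) : Set (ℝ × ℝ) :=
  if 1 / rBar r ≤ c then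
    curveC c
  else if c < 1 / r then
    {P | P ∈ curveC c ∧ P.1 ∈ Set.Icc 1 r} ∪
      {P | P.1 ∈ Set.Icc r (uCoord r c) ∧ P.2 = uCoord r c}
  else
    {P | P ∈ curveC c ∧ P.1 ∈ Set.Icc 1 2} ∪
      {P | P.1 ∈ Set.Icc 2 (wCoord r c) ∧ P.2 = vCoord c}

/-! The two suprema are over bounded sets of reals, and so have no default value. -/

theorem weakSummingNorm_bddAbove {F : Type*} [NormedAddCommGroup F] [NormedSpace ℂ F]
    {p : ℝ} (hp : 1 ≤ p) {n : ℕ} (x : Fin n → F) :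
    BddAbove {t : ℝ | ∃ φ : StrongDual ℂ F, ‖φ‖ ≤ 1 ∧ t = (∑ i, ‖φ (x i)‖ ^ p) ^ (1 / p)} := by
  refine ⟨(∑ i, ‖x i‖ ^ p) ^ (1 / p), ?_⟩
  rintro t ⟨φ, hφ, rfl⟩
  have h : ∀ i, ‖φ (x i)‖ ≤ ‖x i‖ := fun i =>
    (φ.le_opNorm (x i)).trans (mul_le_of_le_one_left (norm_nonneg _) hφ)
  have hp0 : 0 ≤ p := by linarith
  refine Real.rpow_le_rpow (by positivity) ?_ (by positivity)
  exact Finset.sum_le_sum fun i _ => Real.rpow_le_rpow (norm_nonneg _) (h i) hp0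

theorem norm_le_weakSummingNorm {E : Type*} [NormedAddCommGroup E] [NormedSpace ℂ E]
    {p : ℝ} (hp : 1 ≤ p) {n : ℕ} (l : Fin n → StrongDual ℂ E) (i : Fin n) :
    ‖l i‖ ≤ weakSummingNorm p l := by
  have hp0 : 0 < p := by linarith
  have key : ∀ x : E, ‖x‖ ≤ 1 → ‖l i x‖ ≤ weakSummingNorm p l := by
    intro x hx
    have h1 : ‖l i x‖ ≤ (∑ j, ‖l j x‖ ^ p) ^ (1 / p) := by
      calc ‖l i x‖ = (‖l i x‖ ^ p) ^ (1 / p) := by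
            rw [← Real.rpow_mul (norm_nonneg _), mul_one_div_cancel hp0.ne', Real.rpow_one]
        _ ≤ _ := Real.rpow_le_rpow (by positivity)
            (Finset.single_le_sum (f := fun j => ‖l j x‖ ^ p)
              (fun j _ => by positivity) (Finset.mem_univ i)) (by positivity)
    refine h1.trans (le_csSup (weakSummingNorm_bddAbove hp l)
      ⟨NormedSpace.inclusionInDoubleDual ℂ E x, ?_, ?_⟩)
    · exact (NormedSpace.double_dual_bound ℂ E x).trans hx
    · simp [NormedSpace.dual_def]
  have h0 : 0 ≤ weakSummingNorm p l := (norm_nonneg _).trans (key 0 (by simp))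
  refine ContinuousLinearMap.opNorm_le_of_unit_norm h0 ?_
  intro x hx
  exact key x hx.le

theorem pqNorm_bddAbove {E : Type*} [NormedAddCommGroup E] [NormedSpace ℂ E]
    {p q : ℝ} (hp : 1 ≤ p) (hq : p ≤ q) {n : ℕ} (x : Fin n → E) :
    BddAbove {t : ℝ | ∃ l : Fin n → StrongDual ℂ E, weakSummingNorm p l ≤ 1 ∧
      t = (∑ i, ‖l i (x i)‖ ^ q) ^ (1 / q)} := by
  refine ⟨(∑ i, ‖x i‖ ^ q) ^ (1 / q), ?_⟩
  rintro t ⟨l, hl, rfl⟩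
  have h : ∀ i, ‖l i (x i)‖ ≤ ‖x i‖ := fun i =>
    ((l i).le_opNorm (x i)).trans (mul_le_of_le_one_left (norm_nonneg _)
      ((norm_le_weakSummingNorm hp l i).trans hl))
  have hq0 : 0 ≤ q := by linarith
  refine Real.rpow_le_rpow (by positivity) ?_ (by positivity)
  exact Finset.sum_le_sum fun i _ => Real.rpow_le_rpow (norm_nonneg _) (h i) hq0

end MultiNormed

end

/-! Two mechanisms decide equivalence, and both rest on averaging over signs.

Upper bounds: let `l` be weakly `p`-summing, and let the sign sums of `x` satisfy an upper
`s`-estimate with `p < s`. Then `sum_diagonal_rpow_le` puts the diagonal `⟨xᵢ, lᵢ⟩` in `ℓ^t`, where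
`1/t = 1/p - 1/s`. By Khinchine's inequality, applied pointwise and integrated, `L^r` has type `r̄`,
so this holds with `s = r̄` for every bounded tuple. If `1/p - 1/q ≥ 1/r̄`, then `t ≤ q` and the
`(p,q)`-multi-norm is controlled by the minimum multi-norm, which it always dominates. This settles
the curves with `c ≥ 1/r̄`.

Lower bounds: on a complemented copy of `ℓ^s_n` the rescaled biorthogonal functionals are a test
tuple, and they show that the norm of the basis is at least `n^γ` with `γ = 1/q - max(0, 1/p -
1/s)`. The diagonal estimate gives the matching bound `K n^{max(0, γ)}`. The curves `𝒟_c` are built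
so that `γ` is constant along them: it is `1/r - c` for `s = r` and `c < 1/r`, and `1/2 - c` for `s
= 2 ≤ r` and `1/r ≤ c < 1/2`; for larger `c` it is at most `0`. Hence different parameters are
separated by a power of `n`. The copies of `ℓ^r_n` come from disjoint sets (`exists_isLpSystem`),
and those of `ℓ^2_n` for `r ≥ 2` from Rademacher sums inside `ℓ^r_N` with `N = 2^n`
(`exists_isLpSystem_two`). -/

namespace MultiNormed

/-! ### Averages over signs and Khinchine's inequality. -/

/-- The sign attached to a Boolean. -/
def sgn (b : Bool) : ℝ := if b then 1 else -1

theorem sgn_not (b : Bool) : sgn (!b) = -sgn b := by cases b <;> simp [sgn]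

theorem sgn_mul_self (b : Bool) : sgn b * sgn b = 1 := by cases b <;> simp [sgn]

theorem abs_sgn (b : Bool) : |sgn b| = 1 := by cases b <;> simp [sgn]

theorem norm_ofReal_sgn (b : Bool) : ‖(sgn b : ℂ)‖ = 1 := by
  rw [Complex.norm_real, Real.norm_eq_abs, abs_sgn]

theorem card_signs (n : ℕ) : (Fintype.card (Fin n → Bool) : ℝ) = 2 ^ n := by simp

theorem sum_sgn_mul_sgn {n : ℕ} (i j : Fin n) :
    ∑ ω : Fin n → Bool, sgn (ω i) * sgn (ω j) = if i = j then 2 ^ n else 0 := by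
  split_ifs with h
  · subst h
    simp [sgn_mul_self]
  -- Flipping the `i`-th sign permutes the sign vectors and negates the product, so the sum equals
  -- its own negative.
  · let e : (Fin n → Bool) ≃ (Fin n → Bool) :=
      Function.Involutive.toPerm (fun ω => Function.update ω i (!ω i)) (by
        intro ω; simp)
    have h1 := Equiv.sum_comp e (fun ω : Fin n → Bool => sgn (ω i) * sgn (ω j))
    have h2 : ∀ ω, sgn (e ω i) * sgn (e ω j) = -(sgn (ω i) * sgn (ω j)) := by
      intro ω
      have : e ω = Function.update ω i (!ω i) := rfl
      rw [this, Function.update_self, Function.update_of_ne (Ne.symm h), sgn_not]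
      ring
    simp only [h2, Finset.sum_neg_distrib] at h1
    linarith

theorem sum_sgn_mul_sum {n : ℕ} (z : Fin n → ℂ) (i : Fin n) :
    ∑ ω : Fin n → Bool, (sgn (ω i) : ℂ) * ∑ j, (sgn (ω j) : ℂ) * z j = 2 ^ n * z i := by
  simp only [Finset.mul_sum]
  rw [Finset.sum_comm]
  have : ∀ j, ∑ ω : Fin n → Bool, (sgn (ω i) : ℂ) * ((sgn (ω j) : ℂ) * z j)
      = (if i = j then 2 ^ n else 0) * z j := by
    intro j
    have := congrArg (fun t : ℝ => (t : ℂ)) (sum_sgn_mul_sgn i j)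
    simp only [Complex.ofReal_sum, Complex.ofReal_mul] at this
    simp only [← mul_assoc]
    rw [← Finset.sum_mul, this]
    split_ifs <;> simp
  simp [this]

/-- Jensen's inequality for the uniform average over signs. -/
theorem avg_rpow_le {n : ℕ} {u : ℝ} (hu : 1 ≤ u) (F : (Fin n → Bool) → ℝ) (hF : ∀ ω, 0 ≤ F ω) :
    ((∑ ω, F ω) / 2 ^ n) ^ u ≤ (∑ ω, F ω ^ u) / 2 ^ n := by
  have := Real.rpow_arith_mean_le_arith_mean_rpow Finset.univ
    (fun _ : Fin n → Bool => ((2 : ℝ) ^ n)⁻¹) F (fun _ _ => by positivity)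
    (by simp) (fun ω _ => hF ω) hu
  rw [← Finset.mul_sum, ← Finset.mul_sum] at this
  simpa [div_eq_inv_mul] using this

/-- Moments for a probability measure increase with the exponent: this is Jensen's inequality with
exponent `r / p`. -/
theorem avg_rpow_le_rpow {n : ℕ} {p r : ℝ} (hp : 0 < p) (hpr : p ≤ r)
    (F : (Fin n → Bool) → ℝ) (hF : ∀ ω, 0 ≤ F ω) :
    (∑ ω, F ω ^ p) / 2 ^ n ≤ ((∑ ω, F ω ^ r) / 2 ^ n) ^ (p / r) := by
  have hr : 0 < r := hp.trans_le hpr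
  have h := avg_rpow_le ((one_le_div hp).2 hpr) (fun ω => F ω ^ p)
    (fun ω => Real.rpow_nonneg (hF ω) _)
  have h2 : ∀ ω, (F ω ^ p) ^ (r / p) = F ω ^ r := fun ω => by
    rw [← Real.rpow_mul (hF ω), mul_div_cancel₀ _ hp.ne']
  simp only [h2] at h
  have h0 : 0 ≤ (∑ ω, F ω ^ p) / 2 ^ n :=
    div_nonneg (Finset.sum_nonneg fun ω _ => Real.rpow_nonneg (hF ω) _) (by positivity)
  calc (∑ ω, F ω ^ p) / 2 ^ n = (((∑ ω, F ω ^ p) / 2 ^ n) ^ (r / p)) ^ (p / r) := by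
        rw [← Real.rpow_mul h0, div_mul_div_cancel₀ hp.ne', div_self hr.ne', Real.rpow_one]
    _ ≤ _ := Real.rpow_le_rpow (Real.rpow_nonneg h0 _) h (by positivity)

/-- The coefficient of a sign sum is dominated by the average of the sum. -/
theorem norm_coeff_rpow_le {n : ℕ} {p : ℝ} (hp : 1 ≤ p) (z : Fin n → ℂ) (i : Fin n) :
    ‖z i‖ ^ p ≤ (∑ ω : Fin n → Bool, ‖∑ j, (sgn (ω j) : ℂ) * z j‖ ^ p) / 2 ^ n := by
  refine le_trans ?_ (avg_rpow_le hp _ fun ω => norm_nonneg _)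
  refine Real.rpow_le_rpow (norm_nonneg _) ?_ (by linarith)
  rw [le_div_iff₀ (by positivity)]
  calc ‖z i‖ * 2 ^ n = ‖(2 : ℂ) ^ n * z i‖ := by rw [norm_mul, norm_pow]; simp [mul_comm]
    _ = ‖∑ ω : Fin n → Bool, (sgn (ω i) : ℂ) * ∑ j, (sgn (ω j) : ℂ) * z j‖ := by
        rw [sum_sgn_mul_sum]
    _ ≤ ∑ ω : Fin n → Bool, ‖(sgn (ω i) : ℂ) * ∑ j, (sgn (ω j) : ℂ) * z j‖ := norm_sum_le _ _
    _ = _ := by simp only [norm_mul, norm_ofReal_sgn, one_mul]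

/-- The signs are independent, so the exponential moment factors over the coordinates, and each
factor is bounded by `cosh x ≤ exp (x² / 2)`. -/
theorem sum_exp_sgn_le {n : ℕ} (a : Fin n → ℝ) (s : ℝ) :
    ∑ ω : Fin n → Bool, Real.exp (s * ∑ j, sgn (ω j) * a j)
      ≤ 2 ^ n * Real.exp (s ^ 2 * (∑ j, a j ^ 2) / 2) := by
  have h1 : ∀ ω : Fin n → Bool, Real.exp (s * ∑ j, sgn (ω j) * a j)
      = ∏ j, Real.exp (s * (sgn (ω j) * a j)) := fun ω => by
    rw [Finset.mul_sum, Real.exp_sum]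
  simp only [h1]
  have h2 := Finset.prod_univ_sum (fun _ : Fin n => (Finset.univ : Finset Bool))
    (fun j b => Real.exp (s * (sgn b * a j)))
  rw [Fintype.piFinset_univ] at h2
  rw [← h2]
  have h3 : ∀ j, ∑ b : Bool, Real.exp (s * (sgn b * a j)) ≤ 2 * Real.exp ((s * a j) ^ 2 / 2) := by
    intro j
    have := Real.cosh_le_exp_half_sq (s * a j)
    rw [Real.cosh_eq] at this
    have e1 : s * (sgn true * a j) = s * a j := by simp [sgn]
    have e2 : s * (sgn false * a j) = -(s * a j) := by simp [sgn]
    rw [Fintype.sum_bool, e1, e2]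
    linarith
  refine (Finset.prod_le_prod (fun j _ => Finset.sum_nonneg fun b _ => (Real.exp_pos _).le)
    (fun j _ => h3 j)).trans_eq ?_
  rw [Finset.prod_mul_distrib, ← Real.exp_sum]
  simp only [Finset.prod_const, Finset.card_univ, Fintype.card_fin]
  congr 2
  rw [Finset.mul_sum, Finset.sum_div]
  exact Finset.sum_congr rfl fun j _ => by ring

theorem rpow_le_mul_exp {r x : ℝ} (hr : 0 ≤ r) (hx : 0 ≤ x) :
    x ^ r ≤ (1 + (Nat.factorial ⌈r⌉₊ : ℝ)) * Real.exp x := by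
  have h1 : x ^ r ≤ 1 + x ^ ⌈r⌉₊ := by
    rcases le_total x 1 with h | h
    · exact (Real.rpow_le_one hx h hr).trans (le_add_of_nonneg_right (by positivity))
    · rw [← Real.rpow_natCast]
      exact (Real.rpow_le_rpow_of_exponent_le h (Nat.le_ceil r)).trans (by simp)
  have h2 := Real.pow_div_factorial_le_exp x hx ⌈r⌉₊
  rw [div_le_iff₀ (by positivity)] at h2
  have h3 := Real.one_le_exp hx
  nlinarith

/-- Khinchine's inequality (the upper estimate). -/
theorem khinchine {r : ℝ} (hr : 0 < r) : ∃ A : ℝ, 0 < A ∧ ∀ (n : ℕ) (z : Fin n → ℂ),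
    (∑ ω : Fin n → Bool, ‖∑ j, (sgn (ω j) : ℂ) * z j‖ ^ r) / 2 ^ n
      ≤ A * (∑ j, ‖z j‖ ^ 2) ^ (r / 2) := by
  set B : ℝ := 1 + (Nat.factorial ⌈r⌉₊ : ℝ)
  have hB : 0 < B := by positivity
  -- The normalised case. The factor `4` counts the signs of the real and imaginary parts, and `exp
  -- 2` is the exponential moment at `s = ±2`.
  have key : ∀ (n : ℕ) (z : Fin n → ℂ), ∑ j, ‖z j‖ ^ 2 = 1 →
      (∑ ω : Fin n → Bool, ‖∑ j, (sgn (ω j) : ℂ) * z j‖ ^ r) ≤ 4 * B * Real.exp 2 * 2 ^ n := by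
    intro n z hz
    have hab : ∑ j, (z j).re ^ 2 ≤ 1 ∧ ∑ j, (z j).im ^ 2 ≤ 1 := by
      have : ∑ j, (z j).re ^ 2 + ∑ j, (z j).im ^ 2 = 1 := by
        rw [← hz, ← Finset.sum_add_distrib]
        refine Finset.sum_congr rfl fun j _ => ?_
        rw [Complex.sq_norm, Complex.normSq_apply]; ring
      have h1 : 0 ≤ ∑ j, (z j).re ^ 2 := Finset.sum_nonneg fun j _ => sq_nonneg _
      have h2 : 0 ≤ ∑ j, (z j).im ^ 2 := Finset.sum_nonneg fun j _ => sq_nonneg _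
      constructor <;> linarith
    have hexp : ∀ (a : Fin n → ℝ), ∑ j, a j ^ 2 ≤ 1 → ∀ s : ℝ, s ^ 2 = 4 →
        ∑ ω : Fin n → Bool, Real.exp (s * ∑ j, sgn (ω j) * a j) ≤ 2 ^ n * Real.exp 2 := by
      intro a ha s hs
      refine (sum_exp_sgn_le a s).trans ?_
      gcongr
      rw [hs]; linarith
    have habs : ∀ x : ℝ, Real.exp (2 * |x|) ≤ Real.exp (2 * x) + Real.exp ((-2) * x) := by
      intro x
      have h1 := Real.exp_pos (2 * x)
      have h2 := Real.exp_pos ((-2) * x)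
      rcases abs_cases x with ⟨h, _⟩ | ⟨h, _⟩ <;> rw [h]
      · linarith
      · have : 2 * -x = (-2) * x := by ring
        rw [this]; linarith
    have hpt : ∀ ω : Fin n → Bool, ‖∑ j, (sgn (ω j) : ℂ) * z j‖ ^ r ≤
        B * ((Real.exp (2 * ∑ j, sgn (ω j) * (z j).re) +
          Real.exp ((-2) * ∑ j, sgn (ω j) * (z j).re)) +
         (Real.exp (2 * ∑ j, sgn (ω j) * (z j).im) +
          Real.exp ((-2) * ∑ j, sgn (ω j) * (z j).im))) := by
      intro ω
      set S := ∑ j, (sgn (ω j) : ℂ) * z j with hS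
      have hre : S.re = ∑ j, sgn (ω j) * (z j).re := by simp [hS]
      have him : S.im = ∑ j, sgn (ω j) * (z j).im := by simp [hS]
      rw [← hre, ← him]
      refine (rpow_le_mul_exp hr.le (norm_nonneg S)).trans ?_
      refine mul_le_mul_of_nonneg_left ?_ hB.le
      have h1 : ‖S‖ ≤ max (2 * |S.re|) (2 * |S.im|) := by
        refine (Complex.norm_le_abs_re_add_abs_im S).trans ?_
        rcases le_total |S.re| |S.im| with h | h
        · exact le_max_of_le_right (by linarith)
        · exact le_max_of_le_left (by linarith)
      refine (Real.exp_le_exp.2 h1).trans ?_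
      have p1 := habs S.re
      have p2 := habs S.im
      have q1 := Real.exp_pos (2 * |S.re|)
      have q2 := Real.exp_pos (2 * |S.im|)
      rcases max_choice (2 * |S.re|) (2 * |S.im|) with h | h <;> rw [h] <;> linarith
    refine (Finset.sum_le_sum fun ω _ => hpt ω).trans ?_
    rw [← Finset.mul_sum]
    simp only [Finset.sum_add_distrib]
    have e1 := hexp _ hab.1 2 (by norm_num)
    have e2 := hexp _ hab.1 (-2) (by norm_num)
    have e3 := hexp _ hab.2 2 (by norm_num)
    have e4 := hexp _ hab.2 (-2) (by norm_num)
    calc _ ≤ B * ((2 ^ n * Real.exp 2 + 2 ^ n * Real.exp 2)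
          + (2 ^ n * Real.exp 2 + 2 ^ n * Real.exp 2)) := by gcongr
      _ = _ := by ring
  refine ⟨4 * B * Real.exp 2, by positivity, fun n z => ?_⟩
  rw [div_le_iff₀ (by positivity)]
  have hN0 : 0 ≤ ∑ j, ‖z j‖ ^ 2 := Finset.sum_nonneg fun j _ => sq_nonneg _
  rcases hN0.eq_or_lt with h0 | h0
  · have hz : ∀ j, z j = 0 := fun j => by
      have := (Finset.sum_eq_zero_iff_of_nonneg (fun j _ => sq_nonneg ‖z j‖)).1 h0.symm j
        (Finset.mem_univ j)
      simpa using this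
    simp only [hz, mul_zero, Finset.sum_const_zero, norm_zero, Real.zero_rpow hr.ne']
    positivity
  · set N := Real.sqrt (∑ j, ‖z j‖ ^ 2) with hN
    have hNpos : 0 < N := Real.sqrt_pos.2 h0
    have hN2 : N ^ 2 = ∑ j, ‖z j‖ ^ 2 := Real.sq_sqrt hN0
    have hNc : (N : ℂ) ≠ 0 := by exact_mod_cast hNpos.ne'
    have := key n (fun j => z j / N) (by
      simp only [norm_div, div_pow, Complex.norm_real, Real.norm_eq_abs, sq_abs]
      rw [← Finset.sum_div, hN2, div_self h0.ne'])
    have h3 : ∀ ω : Fin n → Bool, ‖∑ j, (sgn (ω j) : ℂ) * z j‖ ^ r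
        = N ^ r * ‖∑ j, (sgn (ω j) : ℂ) * (z j / N)‖ ^ r := by
      intro ω
      rw [← Real.mul_rpow hNpos.le (norm_nonneg _)]
      congr 1
      have : ∑ j, (sgn (ω j) : ℂ) * (z j / N) = (∑ j, (sgn (ω j) : ℂ) * z j) / N := by
        rw [Finset.sum_div]
        exact Finset.sum_congr rfl fun j _ => by ring
      rw [this, norm_div, Complex.norm_real, Real.norm_eq_abs, abs_of_pos hNpos]
      field_simp
    simp only [h3]
    rw [← Finset.mul_sum, ← hN2, ← Real.rpow_natCast N 2, ← Real.rpow_mul hNpos.le]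
    have e : ((2 : ℕ) : ℝ) * (r / 2) = r := by push_cast; ring
    rw [e]
    have hNr : 0 < N ^ r := Real.rpow_pos_of_pos hNpos _
    nlinarith

/-! ### Duality for the weak summing norm, and first bounds on the `(p,q)`-multi-norm. -/

section Duality

variable {E : Type*} [NormedAddCommGroup E] [NormedSpace ℂ E]

theorem rpow_one_div_rpow {a p : ℝ} (ha : 0 ≤ a) (hp : p ≠ 0) : (a ^ (1 / p)) ^ p = a := by
  rw [← Real.rpow_mul ha, one_div_mul_cancel hp, Real.rpow_one]

theorem rpow_rpow_one_div {a p : ℝ} (ha : 0 ≤ a) (hp : p ≠ 0) : (a ^ p) ^ (1 / p) = a := by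
  rw [← Real.rpow_mul ha, mul_one_div_cancel hp, Real.rpow_one]

/-- Evaluation at `x / ‖x‖` is an admissible element of the bidual; homogeneity does the rest. -/
theorem sum_rpow_le_of_weakSummingNorm_le_one {p : ℝ} (hp : 1 ≤ p) {n : ℕ}
    {l : Fin n → StrongDual ℂ E} (hl : weakSummingNorm p l ≤ 1) (x : E) :
    ∑ i, ‖l i x‖ ^ p ≤ ‖x‖ ^ p := by
  have hp0 : 0 < p := by linarith
  rcases eq_or_ne x 0 with rfl | hx
  · simp [Real.zero_rpow hp0.ne']
  have hxn : 0 < ‖x‖ := norm_pos_iff.2 hx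
  set y : E := ((‖x‖⁻¹ : ℝ) : ℂ) • x with hy
  have hy1 : ‖y‖ ≤ 1 := by
    rw [hy, norm_smul, Complex.norm_real, norm_inv, norm_norm, inv_mul_cancel₀ hxn.ne']
  have h0 : 0 ≤ ∑ i, ‖l i y‖ ^ p := Finset.sum_nonneg fun i _ => by positivity
  have h1 : (∑ i, ‖l i y‖ ^ p) ^ (1 / p) ≤ 1 := by
    refine le_trans (le_csSup (weakSummingNorm_bddAbove hp l)
      ⟨NormedSpace.inclusionInDoubleDual ℂ E y, ?_, ?_⟩) hl
    · exact (NormedSpace.double_dual_bound ℂ E y).trans hy1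
    · simp [NormedSpace.dual_def]
  have h2 : ∑ i, ‖l i y‖ ^ p ≤ 1 := by
    rw [← rpow_one_div_rpow h0 hp0.ne']
    exact Real.rpow_le_one (by positivity) h1 hp0.le
  have h3 : ∀ i, ‖l i y‖ ^ p = (‖x‖ ^ p)⁻¹ * ‖l i x‖ ^ p := fun i => by
    rw [hy, map_smul, norm_smul, Complex.norm_real, norm_inv, norm_norm,
      Real.mul_rpow (by positivity) (norm_nonneg _), Real.inv_rpow hxn.le]
  simp only [h3] at h2
  rw [← Finset.mul_sum, inv_mul_le_iff₀ (by positivity), mul_one] at h2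
  exact h2

/-- The weak summing norm of a tuple of functionals is already computed on the space itself. -/
theorem weakSummingNorm_le {p C : ℝ} (hp : 1 ≤ p) (hC : 0 ≤ C) {n : ℕ}
    (l : Fin n → StrongDual ℂ E)
    (h : ∀ x : E, ‖x‖ ≤ 1 → (∑ i, ‖l i x‖ ^ p) ^ (1 / p) ≤ C) : weakSummingNorm p l ≤ C := by
  have hp0 : 0 < p := by linarith
  refine Real.sSup_le ?_ hC
  rintro t ⟨φ, hφ, rfl⟩
  set S := ∑ i, ‖φ (l i)‖ ^ p with hS
  have hS0 : 0 ≤ S := Finset.sum_nonneg fun i _ => by positivity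
  rcases hS0.eq_or_lt with h0 | hSpos
  · rw [← h0, Real.zero_rpow (by positivity)]; exact hC
  have hphase : ∀ i, ∃ c : ℂ, ‖c‖ ≤ 1 ∧ c * φ (l i) = (‖φ (l i)‖ : ℂ) := by
    intro i
    rcases eq_or_ne (φ (l i)) 0 with h0 | h0
    · exact ⟨0, by simp, by simp [h0]⟩
    · refine ⟨(‖φ (l i)‖ : ℂ) / φ (l i), by simp [h0], by field_simp⟩
  choose c hc1 hc2 using hphase
  -- Here `φ` is an arbitrary element of the bidual. The weights and phases make `φ (∑ aᵢ cᵢ lᵢ) =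
  -- S`, while Hölder's inequality on `E` bounds the norm of that functional by `S^{1 - 1/p} C`.
  -- Dividing gives `S^{1/p} ≤ C`.
  set a : Fin n → ℝ := fun i => ‖φ (l i)‖ ^ (p - 1) with ha
  have ha0 : ∀ i, 0 ≤ a i := fun i => by positivity
  have hsum : φ (∑ i, ((a i : ℂ) * c i) • l i) = (S : ℂ) := by
    rw [map_sum, hS, Complex.ofReal_sum]
    refine Finset.sum_congr rfl fun i _ => ?_
    rw [map_smul, smul_eq_mul, mul_assoc, hc2, ← Complex.ofReal_mul]
    congr 1
    rcases (norm_nonneg (φ (l i))).eq_or_lt with h0 | h0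
    · rw [← h0, Real.zero_rpow hp0.ne', mul_zero]
    · simp only [ha]
      rw [← Real.rpow_add_one h0.ne']; congr 1; ring
  have hholder : ∀ x : E, ‖x‖ ≤ 1 → ∑ i, a i * ‖l i x‖ ≤ S ^ (1 - 1 / p) * C := by
    intro x hx
    have hx' := h x hx
    -- For `p = 1` the conjugate exponent is infinite, but all the weights are `1` and no Hölder
    -- inequality is needed.
    rcases hp.eq_or_lt with h1 | h1
    · subst h1
      simpa [ha] using hx'
    · have hpq : (p / (p - 1)).HolderConjugate p :=
        (Real.HolderConjugate.conjExponent h1).symm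
      refine (Real.inner_le_Lp_mul_Lq_of_nonneg Finset.univ hpq (fun i _ => ha0 i)
        (fun i _ => norm_nonneg (l i x))).trans ?_
      have e1 : ∀ i, a i ^ (p / (p - 1)) = ‖φ (l i)‖ ^ p := fun i => by
        simp only [ha]
        rw [← Real.rpow_mul (norm_nonneg _), mul_div_cancel₀ _ (by linarith)]
      have e2 : 1 / (p / (p - 1)) = 1 - 1 / p := by
        have : p - 1 ≠ 0 := by linarith
        field_simp
      simp only [e1, e2]
      gcongr
  have hnorm : ‖∑ i, ((a i : ℂ) * c i) • l i‖ ≤ S ^ (1 - 1 / p) * C := by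
    refine ContinuousLinearMap.opNorm_le_of_unit_norm (by positivity) fun x hx => ?_
    refine le_trans ?_ (hholder x hx.le)
    rw [sum_apply]
    refine (norm_sum_le _ _).trans (Finset.sum_le_sum fun i _ => ?_)
    rw [smul_apply, norm_smul, norm_mul, Complex.norm_real, Real.norm_eq_abs,
      abs_of_nonneg (ha0 i)]
    gcongr
    exact mul_le_of_le_one_right (ha0 i) (hc1 i)
  have hfin : S ≤ S ^ (1 - 1 / p) * C := by
    have h1 := (φ.le_opNorm (∑ i, ((a i : ℂ) * c i) • l i)).trans
      (mul_le_of_le_one_left (norm_nonneg _) hφ)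
    rw [hsum, Complex.norm_real, Real.norm_eq_abs, abs_of_nonneg hS0] at h1
    exact h1.trans hnorm
  rw [sub_eq_add_neg, Real.rpow_add hSpos, Real.rpow_one, Real.rpow_neg hS0, mul_assoc] at hfin
  have h2 : 1 ≤ (S ^ (1 / p))⁻¹ * C := le_of_mul_le_mul_left (by linarith) hSpos
  rwa [le_inv_mul_iff₀ (by positivity), mul_one] at h2

theorem pqNorm_le {p q C : ℝ} (hC : 0 ≤ C) {n : ℕ} (x : Fin n → E)
    (h : ∀ l : Fin n → StrongDual ℂ E, weakSummingNorm p l ≤ 1 →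
      (∑ i, ‖l i (x i)‖ ^ q) ^ (1 / q) ≤ C) : pqNorm p q n x ≤ C := by
  refine Real.sSup_le ?_ hC
  rintro t ⟨l, hl, rfl⟩
  exact h l hl

theorem le_pqNorm {p q : ℝ} (hp : 1 ≤ p) (hpq : p ≤ q) {n : ℕ} (x : Fin n → E)
    {l : Fin n → StrongDual ℂ E} (hl : weakSummingNorm p l ≤ 1) :
    (∑ i, ‖l i (x i)‖ ^ q) ^ (1 / q) ≤ pqNorm p q n x :=
  le_csSup (pqNorm_bddAbove hp hpq x) ⟨l, hl, rfl⟩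

theorem pqNorm_nonneg {p q : ℝ} {n : ℕ} (x : Fin n → E) : 0 ≤ pqNorm p q n x := by
  refine Real.sSup_nonneg ?_
  rintro t ⟨l, -, rfl⟩
  positivity

/-- The test tuple has a norming functional of `x i` in place `i` and zeros elsewhere. -/
theorem norm_le_pqNorm {p q : ℝ} (hp : 1 ≤ p) (hpq : p ≤ q) {n : ℕ} (x : Fin n → E) (i : Fin n) :
    ‖x i‖ ≤ pqNorm p q n x := by
  have hp0 : 0 < p := by linarith
  have hq0 : 0 < q := by linarith
  obtain ⟨g, hg1, hg2⟩ := exists_dual_vector'' ℂ (x i)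
  have hsum : ∀ (u : ℝ), 0 < u → ∀ y : Fin n → E,
      ∑ j, ‖(Pi.single i g : Fin n → StrongDual ℂ E) j (y j)‖ ^ u = ‖g (y i)‖ ^ u := by
    intro u hu y
    rw [Finset.sum_eq_single i, Pi.single_eq_same]
    · intro j _ hj
      rw [Pi.single_eq_of_ne hj]; simp [Real.zero_rpow hu.ne']
    · simp
  have hl : weakSummingNorm p (Pi.single i g : Fin n → StrongDual ℂ E) ≤ 1 := by
    refine weakSummingNorm_le hp zero_le_one _ fun y hy => ?_
    rw [hsum p hp0 fun _ => y, rpow_rpow_one_div (norm_nonneg _) hp0.ne']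
    exact (g.le_opNorm y).trans (mul_le_one₀ hg1 (norm_nonneg _) hy)
  have := le_pqNorm hp hpq x hl
  rw [hsum q hq0, rpow_rpow_one_div (norm_nonneg _) hq0.ne', hg2] at this
  simpa using this

end Duality

/-! ### Comparison of finite-dimensional `ℓ^t` norms. -/

section Exponents

theorem sum_rpow_le_one_of_le {n : ℕ} {d : Fin n → ℝ} (hd : ∀ i, 0 ≤ d i) {t q : ℝ} (ht : 0 < t)
    (htq : t ≤ q) (h : ∑ i, d i ^ t ≤ 1) : ∑ i, d i ^ q ≤ 1 := by
  refine le_trans (Finset.sum_le_sum fun i _ => ?_) h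
  have h1 : d i ^ t ≤ 1 := (Finset.single_le_sum (f := fun i => d i ^ t)
    (fun j _ => Real.rpow_nonneg (hd j) t) (Finset.mem_univ i)).trans h
  have h2 : d i ≤ 1 := by
    rw [← rpow_rpow_one_div (hd i) ht.ne']
    exact Real.rpow_le_one (Real.rpow_nonneg (hd i) _) h1 (by positivity)
  rcases (hd i).eq_or_lt with h0 | h0
  · rw [← h0, Real.zero_rpow ht.ne', Real.zero_rpow (by linarith)]
  · exact Real.rpow_le_rpow_of_exponent_ge h0 h2 htq

/-- Comparison of the `ℓ^t` and `ℓ^q` norms on `n` coordinates. -/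
theorem lpNorm_le_card_rpow {n : ℕ} (hn : 0 < n) {d : Fin n → ℝ} (hd : ∀ i, 0 ≤ d i) {t q : ℝ}
    (ht : 0 < t) (hq : 0 < q) (h : ∑ i, d i ^ t ≤ 1) :
    (∑ i, d i ^ q) ^ (1 / q) ≤ (n : ℝ) ^ max 0 (1 / q - 1 / t) := by
  have hn1 : (1 : ℝ) ≤ n := by exact_mod_cast hn
  have hn0 : (0 : ℝ) < n := by linarith
  have h0 : 0 ≤ ∑ i, d i ^ q := Finset.sum_nonneg fun i _ => Real.rpow_nonneg (hd i) _
  rcases le_total t q with htq | hqt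
  · refine (Real.rpow_le_one h0 (sum_rpow_le_one_of_le hd ht htq h) (by positivity)).trans ?_
    exact Real.one_le_rpow hn1 (le_max_left _ _)
  · have h1 := Real.rpow_sum_le_const_mul_sum_rpow Finset.univ (fun i => d i ^ q)
      ((one_le_div hq).2 hqt)
    have h2 : ∀ i, |d i ^ q| = d i ^ q := fun i => abs_of_nonneg (Real.rpow_nonneg (hd i) _)
    have h3 : ∀ i, (d i ^ q) ^ (t / q) = d i ^ t := fun i => by
      rw [← Real.rpow_mul (hd i), mul_div_cancel₀ _ hq.ne']
    simp only [h2, h3, Finset.card_univ, Fintype.card_fin] at h1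
    have h4 : (∑ i, d i ^ q) ^ (t / q) ≤ (n : ℝ) ^ (t / q - 1) :=
      h1.trans (mul_le_of_le_one_right (by positivity) h)
    calc (∑ i, d i ^ q) ^ (1 / q) = ((∑ i, d i ^ q) ^ (t / q)) ^ (1 / t) := by
          rw [← Real.rpow_mul h0]; congr 1; field_simp
      _ ≤ ((n : ℝ) ^ (t / q - 1)) ^ (1 / t) :=
          Real.rpow_le_rpow (Real.rpow_nonneg h0 _) h4 (by positivity)
      _ = (n : ℝ) ^ (1 / q - 1 / t) := by
          rw [← Real.rpow_mul hn0.le]; congr 1; field_simp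
      _ ≤ _ := Real.rpow_le_rpow_of_exponent_le hn1 (le_max_right _ _)

end Exponents

/-! ### The diagonal estimate and growth on `ℓ^s` systems. -/

section Diagonal

variable {E : Type*} [NormedAddCommGroup E] [NormedSpace ℂ E]

/-- If the sign averages of `x` satisfy an upper `s`-estimate in the `p`-th moment, then the
diagonal `(⟨xᵢ, lᵢ⟩)` of a weakly `p`-summing tuple `l` lies in `ℓ^t`, where `1/t = 1/p - 1/s`. -/
theorem sum_diagonal_rpow_le {p s t K : ℝ} (hp : 1 ≤ p) (hps : p < s) (ht : 0 < t)
    (hts : 1 / t = 1 / p - 1 / s) (hK : 0 ≤ K) {n : ℕ} {l : Fin n → StrongDual ℂ E}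
    (hl : weakSummingNorm p l ≤ 1) (x : Fin n → E)
    (hx : ∀ b : Fin n → ℝ, (∀ i, 0 ≤ b i) →
      (∑ ω : Fin n → Bool, ‖∑ j, (sgn (ω j) : ℂ) • (b j : ℂ) • x j‖ ^ p) / 2 ^ n
        ≤ (K * (∑ j, b j ^ s) ^ (1 / s)) ^ p) :
    ∑ i, ‖l i (x i)‖ ^ t ≤ K ^ t := by
  have hp0 : 0 < p := by linarith
  have hs0 : 0 < s := by linarith
  set d : Fin n → ℝ := fun i => ‖l i (x i)‖ with hd
  have hd0 : ∀ i, 0 ≤ d i := fun i => norm_nonneg _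
  set T := ∑ i, d i ^ t with hT
  have hT0 : 0 ≤ T := Finset.sum_nonneg fun i _ => Real.rpow_nonneg (hd0 i) _
  change T ≤ K ^ t
  rcases hT0.eq_or_lt with h0 | hTpos
  · rw [← h0]; positivity
  -- The exponent makes both `bᵢ^s` and `(bᵢ dᵢ)^p` equal to `dᵢ^t`, since `p (t/s + 1) = t`. Both
  -- sides of the estimate are then powers of `T`.
  set b : Fin n → ℝ := fun i => d i ^ (t / s) with hb
  have hb0 : ∀ i, 0 ≤ b i := fun i => Real.rpow_nonneg (hd0 i) _
  have hbs : ∑ j, b j ^ s = T := Finset.sum_congr rfl fun i _ => by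
    simp only [hb]
    rw [← Real.rpow_mul (hd0 i), div_mul_cancel₀ _ hs0.ne']
  have hexp : p * (t / s + 1) = t := by
    have h1 : t * (1 / t) = t * (1 / p - 1 / s) := by rw [hts]
    rw [mul_one_div_cancel ht.ne'] at h1
    rw [show t / s + 1 = t / s + t * (1 / p - 1 / s) by rw [← h1]]
    field_simp
    ring
  have hbd : ∀ i, (b i * d i) ^ p = d i ^ t := fun i => by
    rcases (hd0 i).eq_or_lt with h0 | h0
    · rw [← h0, mul_zero, Real.zero_rpow hp0.ne', Real.zero_rpow ht.ne']
    · simp only [hb]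
      rw [← Real.rpow_add_one h0.ne', ← Real.rpow_mul h0.le, mul_comm, hexp]
  -- Sign averaging isolates the diagonal term of `lᵢ (∑ ± bⱼ xⱼ)`. Summed over `i`, weak
  -- `p`-summability applies at each fixed choice of signs.
  have hpt : ∀ i, (b i * d i) ^ p ≤
      (∑ ω : Fin n → Bool, ‖l i (∑ j, (sgn (ω j) : ℂ) • (b j : ℂ) • x j)‖ ^ p) / 2 ^ n := by
    intro i
    have := norm_coeff_rpow_le hp (fun j => (b j : ℂ) * l i (x j)) i
    rw [norm_mul, Complex.norm_real, Real.norm_eq_abs, abs_of_nonneg (hb0 i)] at this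
    simpa only [map_sum, map_smul, smul_eq_mul] using this
  have h1 : T ≤ (K * T ^ (1 / s)) ^ p := by
    have h2 := hx b hb0
    rw [hbs] at h2
    refine le_trans ?_ h2
    calc T = ∑ i, (b i * d i) ^ p := Finset.sum_congr rfl fun i _ => (hbd i).symm
      _ ≤ ∑ i, (∑ ω : Fin n → Bool, ‖l i (∑ j, (sgn (ω j) : ℂ) • (b j : ℂ) • x j)‖ ^ p) / 2 ^ n :=
          Finset.sum_le_sum fun i _ => hpt i
      _ = (∑ ω : Fin n → Bool, ∑ i, ‖l i (∑ j, (sgn (ω j) : ℂ) • (b j : ℂ) • x j)‖ ^ p) / 2 ^ n := by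
          rw [← Finset.sum_div, Finset.sum_comm]
      _ ≤ _ := by
          gcongr
          exact sum_rpow_le_of_weakSummingNorm_le_one hp hl _
  have h3 : T ^ (1 / p) ≤ K * T ^ (1 / s) := by
    have := Real.rpow_le_rpow hT0 h1 (by positivity : 0 ≤ 1 / p)
    rwa [rpow_rpow_one_div (by positivity) hp0.ne'] at this
  have h4 : T ^ (1 / t) ≤ K := by
    rw [hts, Real.rpow_sub hTpos, div_le_iff₀ (by positivity)]
    exact h3
  calc T = (T ^ (1 / t)) ^ t := (rpow_one_div_rpow hT0 ht.ne').symm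
    _ ≤ K ^ t := Real.rpow_le_rpow (by positivity) h4 ht.le

/-- A tuple `f` in `E` with biorthogonal functionals `g` that span a complemented copy
of the `n`-dimensional `ℓ^s`. -/
structure IsLpSystem (s K : ℝ) {n : ℕ} (f : Fin n → E) (g : Fin n → StrongDual ℂ E) : Prop where
  apply_self : ∀ i, g i (f i) = 1
  norm_sum_le : ∀ b : Fin n → ℂ, ‖∑ j, b j • f j‖ ≤ K * (∑ j, ‖b j‖ ^ s) ^ (1 / s)
  sum_le : ∀ x, ∑ i, ‖g i x‖ ^ s ≤ ‖x‖ ^ s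

/-- The exponent of growth of the `(p,q)`-multi-norm on `ℓ^s` systems. -/
noncomputable def growth (s : ℝ) (P : ℝ × ℝ) : ℝ := 1 / P.2 - max 0 (1 / P.1 - 1 / s)

/-- The functionals `g` have weak `p`-norm at most `n^e` with `e = max(0, 1/p - 1/s)`. Scaled by
`n^{-e}` they are admissible, and their diagonal on `f` is constant. -/
theorem IsLpSystem.rpow_growth_le {s K : ℝ} (hs : 0 < s) {n : ℕ} (hn : 0 < n) {f : Fin n → E}
    {g : Fin n → StrongDual ℂ E} (h : IsLpSystem s K f g) {P : ℝ × ℝ} (hP : P ∈ triangle) :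
    (n : ℝ) ^ growth s P ≤ pqNorm P.1 P.2 n f := by
  obtain ⟨p, q⟩ := P
  obtain ⟨hp, hpq⟩ := hP
  simp only [growth] at *
  have hp0 : 0 < p := by linarith
  have hq0 : 0 < q := by linarith
  have hn0 : (0 : ℝ) < n := by exact_mod_cast hn
  set e := max 0 (1 / p - 1 / s)
  set m : ℝ := (n : ℝ) ^ (-e) with hm
  have hm0 : 0 < m := by positivity
  have hnorm : ∀ (i : Fin n) (y : E), ‖((m : ℂ) • g i) y‖ = m * ‖g i y‖ := fun i y => by
    rw [smul_apply, norm_smul, Complex.norm_real, Real.norm_eq_abs,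
      abs_of_pos hm0]
  have hl : weakSummingNorm p (fun i => (m : ℂ) • g i) ≤ 1 := by
    refine weakSummingNorm_le hp zero_le_one _ fun x hx => ?_
    have h1 : ∑ i, ‖g i x‖ ^ s ≤ 1 :=
      (h.sum_le x).trans (Real.rpow_le_one (norm_nonneg _) hx hs.le)
    have h2 := lpNorm_le_card_rpow hn (fun i => norm_nonneg (g i x)) hs hp0 h1
    simp only [hnorm, Real.mul_rpow hm0.le (norm_nonneg _)]
    rw [← Finset.mul_sum, Real.mul_rpow (by positivity)
      (Finset.sum_nonneg fun i _ => by positivity), rpow_rpow_one_div hm0.le hp0.ne']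
    calc m * _ ≤ m * (n : ℝ) ^ e := by gcongr
      _ = 1 := by rw [hm, ← Real.rpow_add hn0]; simp
  refine le_trans (le_of_eq ?_) (le_pqNorm hp hpq f hl)
  simp only [hnorm, h.apply_self, norm_one, mul_one]
  rw [Finset.sum_const, Finset.card_univ, Fintype.card_fin, nsmul_eq_mul,
    Real.mul_rpow hn0.le (by positivity), rpow_rpow_one_div hm0.le hq0.ne', hm,
    ← Real.rpow_add hn0]
  congr 1

/-- For `p < s` the diagonal lies in `ℓ^t`, and passing to `ℓ^q` on `n` coordinates costs the stated
power. For `p ≥ s` the bound `K` on each entry suffices. -/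
theorem IsLpSystem.pqNorm_le {s K : ℝ} (hs : 0 < s) (hK : 0 < K) {n : ℕ} (hn : 0 < n)
    {f : Fin n → E} {g : Fin n → StrongDual ℂ E} (h : IsLpSystem s K f g) {P : ℝ × ℝ}
    (hP : P ∈ triangle) :
    pqNorm P.1 P.2 n f ≤ K * (n : ℝ) ^ max 0 (growth s P) := by
  obtain ⟨p, q⟩ := P
  obtain ⟨hp, hpq⟩ := hP
  simp only [growth] at *
  have hp0 : 0 < p := by linarith
  have hq0 : 0 < q := by linarith
  refine MultiNormed.pqNorm_le (by positivity) f fun l hl => ?_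
  have hscale : (∑ i, ‖l i (f i)‖ ^ q) ^ (1 / q)
      = K * (∑ i, (‖l i (f i)‖ / K) ^ q) ^ (1 / q) := by
    have : ∀ i, (‖l i (f i)‖ / K) ^ q = (K ^ q)⁻¹ * ‖l i (f i)‖ ^ q := fun i => by
      rw [Real.div_rpow (norm_nonneg _) hK.le, div_eq_inv_mul]
    simp only [this]
    rw [← Finset.mul_sum, Real.mul_rpow (by positivity)
      (Finset.sum_nonneg fun i _ => by positivity), Real.inv_rpow (by positivity),
      rpow_rpow_one_div hK.le hq0.ne', mul_inv_cancel_left₀ hK.ne']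
  rw [hscale]
  refine mul_le_mul_of_nonneg_left ?_ hK.le
  rcases lt_or_ge p s with hps | hsp
  · have hinv : 0 < 1 / p - 1 / s := sub_pos.2 (one_div_lt_one_div_of_lt hp0 hps)
    set t := 1 / (1 / p - 1 / s) with ht
    have ht0 : 0 < t := by positivity
    have hts : 1 / t = 1 / p - 1 / s := by rw [ht, one_div_one_div]
    -- The upper `s`-estimate of the system ignores the signs of the coefficients, so the average is
    -- bounded term by term.
    have hdiag := sum_diagonal_rpow_le hp hps ht0 hts hK.le hl f (fun b hb => by
      rw [div_le_iff₀ (by positivity)]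
      refine (Finset.sum_le_card_nsmul _ _ ((K * (∑ j, b j ^ s) ^ (1 / s)) ^ p)
        fun ω _ => ?_).trans_eq ?_
      · refine Real.rpow_le_rpow (norm_nonneg _) ?_ hp0.le
        have := h.norm_sum_le fun j => (sgn (ω j) : ℂ) * (b j : ℂ)
        simp only [norm_mul, Complex.norm_real, Real.norm_eq_abs, abs_sgn, one_mul,
          abs_of_nonneg (hb _)] at this
        simpa only [mul_smul] using this
      · rw [Finset.card_univ, nsmul_eq_mul, card_signs, mul_comm])
    have h1 : ∑ i, (‖l i (f i)‖ / K) ^ t ≤ 1 := by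
      simp only [Real.div_rpow (norm_nonneg _) hK.le]
      rw [← Finset.sum_div, div_le_one (by positivity)]
      exact hdiag
    have h2 := lpNorm_le_card_rpow hn (fun i => by positivity) ht0 hq0 h1
    rwa [hts, ← max_eq_right hinv.le] at h2
  · have hinv : max 0 (1 / p - 1 / s) = 0 :=
      max_eq_left (sub_nonpos.2 (one_div_le_one_div_of_le hs hsp))
    rw [hinv, sub_zero, max_eq_right (by positivity)]
    refine Real.rpow_le_rpow (Finset.sum_nonneg fun i _ => by positivity) ?_ (by positivity)
    refine (Finset.sum_le_card_nsmul _ _ 1 fun i _ => ?_).trans_eq (by simp)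
    refine Real.rpow_le_one (by positivity) ((div_le_one hK).2 ?_) hq0.le
    have h1 : ‖l i‖ ≤ 1 := (norm_le_weakSummingNorm hp l i).trans hl
    have h2 : ‖f i‖ ≤ K := by
      have := h.norm_sum_le (Pi.single i 1)
      rw [Finset.sum_eq_single i (by intro j _ hj; simp [hj]) (by simp)] at this
      rw [Finset.sum_eq_single i (by intro j _ hj; simp [hj, Real.zero_rpow hs.ne']) (by simp)]
        at this
      simpa using this
    exact ((l i).le_opNorm _).trans ((mul_le_of_le_one_left (norm_nonneg _) h1).trans h2)

/-- The growth exponent on `ℓ^s` systems obstructs domination. -/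
theorem not_dominates_of_growth_lt {s K : ℝ} (hs : 0 < s) (hK : 0 < K)
    (hsys : ∀ n : ℕ, ∃ (f : Fin n → E) (g : Fin n → StrongDual ℂ E), IsLpSystem s K f g)
    {P₁ P₂ : ℝ × ℝ} (hP₁ : P₁ ∈ triangle) (hP₂ : P₂ ∈ triangle)
    (h : max 0 (growth s P₂) < growth s P₁) :
    ¬ Dominates (pqNorm (E := E) P₂.1 P₂.2) (pqNorm (E := E) P₁.1 P₁.2) := by
  rintro ⟨C, hC, hdom⟩
  set δ := growth s P₁ - max 0 (growth s P₂) with hδ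
  have hδ0 : 0 < δ := sub_pos.2 h
  have hbound : ∀ n : ℕ, 0 < n → (n : ℝ) ^ δ ≤ C * K := by
    intro n hn
    have hn0 : (0 : ℝ) < n := by exact_mod_cast hn
    obtain ⟨f, g, hfg⟩ := hsys n
    have h1 := (hfg.rpow_growth_le hs hn hP₁).trans ((hdom n f).trans
      (mul_le_mul_of_nonneg_left (hfg.pqNorm_le hs hK hn hP₂) hC.le))
    rw [hδ, Real.rpow_sub hn0, div_le_iff₀ (by positivity), mul_assoc]
    exact h1
  have := (tendsto_rpow_atTop hδ0).comp (tendsto_natCast_atTop_atTop (R := ℝ))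
  obtain ⟨n, hn1, hn2⟩ := ((this.eventually_gt_atTop (C * K)).and
    (Filter.eventually_gt_atTop 0)).exists
  exact absurd (hbound n hn2) (not_le.2 hn1)

end Diagonal

/-! ### Type of `L^r`, and disjoint sets in its measure space. -/

section LpSpace

variable {Ω : Type*} [MeasurableSpace Ω] {μ : Measure Ω} {r : ℝ}

theorem integrable_norm_rpow_Lp (hr : 1 < r) [Fact (1 ≤ ENNReal.ofReal r)]
    (f : Lp ℂ (ENNReal.ofReal r) μ) : Integrable (fun ω => ‖f ω‖ ^ r) μ := by
  have := (Lp.memLp f).integrable_norm_rpow (by simp; linarith) ENNReal.ofReal_ne_top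
  rwa [ENNReal.toReal_ofReal (by linarith)] at this

theorem norm_rpow_eq_integral (hr : 1 < r) [Fact (1 ≤ ENNReal.ofReal r)]
    (f : Lp ℂ (ENNReal.ofReal r) μ) : ‖f‖ ^ r = ∫ ω, ‖f ω‖ ^ r ∂μ := by
  have hr0 : 0 < r := by linarith
  have h0 : 0 ≤ ∫ ω, ‖f ω‖ ^ r ∂μ := integral_nonneg fun ω => by positivity
  rw [Lp.norm_def, (Lp.memLp f).eLpNorm_eq_integral_rpow_norm (by simp; linarith)
    ENNReal.ofReal_ne_top, ENNReal.toReal_ofReal hr0.le, ENNReal.toReal_ofReal (by positivity),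
    ← Real.rpow_mul h0, inv_mul_cancel₀ hr0.ne', Real.rpow_one]

theorem coeFn_sum_smul [Fact (1 ≤ ENNReal.ofReal r)] {ι : Type*} (s : Finset ι) (b : ι → ℂ)
    (f : ι → Lp ℂ (ENNReal.ofReal r) μ) :
    (∑ j ∈ s, b j • f j : Lp ℂ (ENNReal.ofReal r) μ) =ᵐ[μ] fun ω => ∑ j ∈ s, b j * f j ω := by
  classical
  induction s using Finset.induction_on with
  | empty =>
    filter_upwards [Lp.coeFn_zero ℂ (ENNReal.ofReal r) μ] with ω hω
    simpa using hω
  | insert i s hi ih =>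
    rw [Finset.sum_insert hi]
    filter_upwards [Lp.coeFn_add (b i • f i) (∑ j ∈ s, b j • f j), Lp.coeFn_smul (b i) (f i), ih]
      with ω h1 h2 h3
    rw [h1, Pi.add_apply, h2, h3, Finset.sum_insert hi, Pi.smul_apply, smul_eq_mul]

/-- A scalar inequality between `r`-th powers of linear forms passes to `L^r`. -/
theorem sum_norm_rpow_le_of_scalar (hr : 1 < r) [Fact (1 ≤ ENNReal.ofReal r)] {I : Type*}
    [Fintype I] {n : ℕ} (m : I → Fin n → ℂ) (a : Fin n → ℝ)
    (h : ∀ z : Fin n → ℂ, ∑ i, ‖∑ j, m i j * z j‖ ^ r ≤ ∑ j, a j * ‖z j‖ ^ r)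
    (x : Fin n → Lp ℂ (ENNReal.ofReal r) μ) :
    ∑ i, ‖∑ j, m i j • x j‖ ^ r ≤ ∑ j, a j * ‖x j‖ ^ r := by
  simp only [norm_rpow_eq_integral hr, ← integral_const_mul]
  rw [← integral_finsetSum _ fun i _ => integrable_norm_rpow_Lp hr _,
    ← integral_finsetSum _ fun i _ => (integrable_norm_rpow_Lp hr _).const_mul _]
  refine integral_mono_ae (integrable_finsetSum _ fun i _ => integrable_norm_rpow_Lp hr _)
    (integrable_finsetSum _ fun i _ => (integrable_norm_rpow_Lp hr _).const_mul _) ?_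
  have : ∀ᵐ ω ∂μ, ∀ i, (∑ j, m i j • x j : Lp ℂ (ENNReal.ofReal r) μ) ω = ∑ j, m i j * x j ω :=
    ae_all_iff.2 fun i => coeFn_sum_smul _ _ _
  filter_upwards [this] with ω hω
  simp only [hω]
  exact h _

theorem sum_rpow_rpow_le {n : ℕ} {u : Fin n → ℝ} (hu : ∀ i, 0 ≤ u i) {θ : ℝ} (h0 : 0 ≤ θ)
    (h1 : θ ≤ 1) (hθ : θ ≠ 0) : (∑ i, u i) ^ θ ≤ ∑ i, u i ^ θ := by
  refine Finset.le_sum_of_subadditive_on_pred (fun y : ℝ => y ^ θ) (fun y => 0 ≤ y)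
    (Real.zero_rpow hθ).le (fun x y hx hy => Real.rpow_add_le_add_rpow hx hy h0 h1)
    (fun x y hx hy => add_nonneg hx hy) u fun i _ => hu i

/-- `L^r` has type `min 2 r`. -/
theorem exists_type_const (μ : Measure Ω) (hr : 1 < r) [Fact (1 ≤ ENNReal.ofReal r)] :
    ∃ A : ℝ, 0 < A ∧ ∀ (n : ℕ) (x : Fin n → Lp ℂ (ENNReal.ofReal r) μ) (M : ℝ), 0 ≤ M →
      (∀ i, ‖x i‖ ≤ M) → ∀ b : Fin n → ℝ, (∀ i, 0 ≤ b i) →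
      (∑ ω : Fin n → Bool, ‖∑ j, (sgn (ω j) : ℂ) • (b j : ℂ) • x j‖ ^ r) / 2 ^ n
        ≤ A * M ^ r * (∑ j, b j ^ rBar r) ^ (r / rBar r) := by
  have hr0 : 0 < r := by linarith
  obtain ⟨A, hA, hkh⟩ := khinchine hr0
  refine ⟨A, hA, fun n x M hM hx b hb => ?_⟩
  -- By Khinchine's inequality and integration, it is enough to bound the square function by a
  -- weighted sum of `r`-th powers whose total weight is right.
  have key : ∀ a : Fin n → ℝ, (∀ j, 0 ≤ a j) → (∑ j, a j ≤ (∑ j, b j ^ rBar r) ^ (r / rBar r)) →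
      (∀ z : Fin n → ℂ, (∑ j, ‖(b j : ℂ) * z j‖ ^ 2) ^ (r / 2) ≤ ∑ j, a j * ‖z j‖ ^ r) →
      (∑ ω : Fin n → Bool, ‖∑ j, (sgn (ω j) : ℂ) • (b j : ℂ) • x j‖ ^ r) / 2 ^ n
        ≤ A * M ^ r * (∑ j, b j ^ rBar r) ^ (r / rBar r) := by
    intro a ha0 ha haz
    have h1 := sum_norm_rpow_le_of_scalar hr (fun (ω : Fin n → Bool) j => (sgn (ω j) : ℂ) * b j)
      (fun j => 2 ^ n * A * a j) (fun z => by
        have h2 := hkh n fun j => (b j : ℂ) * z j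
        rw [div_le_iff₀ (by positivity)] at h2
        simp only [mul_assoc]
        refine h2.trans ?_
        rw [← Finset.mul_sum, ← Finset.mul_sum, mul_comm]
        gcongr
        exact haz z) x
    simp only [mul_smul] at h1
    rw [div_le_iff₀ (by positivity)]
    refine h1.trans ?_
    calc ∑ j, 2 ^ n * A * a j * ‖x j‖ ^ r ≤ ∑ j, 2 ^ n * A * a j * M ^ r := by
          gcongr with j
          · have := ha0 j
            positivity
          · exact hx j
      _ = A * M ^ r * (∑ j, a j) * 2 ^ n := by
          rw [← Finset.sum_mul, ← Finset.mul_sum]; ring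
      _ ≤ _ := by gcongr
  have hnorm : ∀ z : Fin n → ℂ, ∀ j, ‖(b j : ℂ) * z j‖ ^ 2 = b j ^ 2 * ‖z j‖ ^ 2 := fun z j => by
    rw [norm_mul, mul_pow, Complex.norm_real, Real.norm_eq_abs, sq_abs]
  rcases le_total r 2 with h2 | h2
  · have hb' : rBar r = r := min_eq_right h2
    -- For `r ≤ 2`: subadditivity of `y ↦ y^{r/2}`.
    refine key (fun j => b j ^ r) (fun j => Real.rpow_nonneg (hb j) _) ?_ fun z => ?_
    · rw [hb', div_self hr0.ne', Real.rpow_one]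
    · refine (sum_rpow_rpow_le (fun j => by positivity) (by positivity) (by linarith)
        (by positivity)).trans_eq (Finset.sum_congr rfl fun j _ => ?_)
      rw [hnorm, ← mul_pow, ← Real.rpow_natCast, ← Real.rpow_mul (mul_nonneg (hb j) (norm_nonneg _)),
        ← Real.mul_rpow (hb j) (norm_nonneg _)]
      congr 1
      push_cast; ring
  · have hb' : rBar r = 2 := min_eq_left h2
    have hB0 : 0 ≤ ∑ j, b j ^ 2 := Finset.sum_nonneg fun j _ => sq_nonneg _
    -- For `r ≥ 2`: Hölder's inequality with weights `bⱼ²`; the leading factor is the normalisation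
    -- of these weights.
    refine key (fun j => (∑ i, b i ^ 2) ^ (r / 2 - 1) * b j ^ 2) (fun j => by positivity) ?_
      fun z => ?_
    · rw [hb', ← Finset.mul_sum]
      simp only [Real.rpow_two]
      rcases hB0.eq_or_lt with h0 | h0
      · rw [← h0, mul_zero]; positivity
      · rw [← Real.rpow_add_one h0.ne', sub_add_cancel]
    · have h3 := Real.inner_le_weight_mul_Lp_of_nonneg Finset.univ (p := r / 2) (by linarith)
        (fun j => b j ^ 2) (fun j => ‖z j‖ ^ 2) (fun j => sq_nonneg _) (fun j => sq_nonneg _)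
      have h4 : ∀ j, (‖z j‖ ^ 2) ^ (r / 2) = ‖z j‖ ^ r := fun j => by
        rw [← Real.rpow_natCast, ← Real.rpow_mul (norm_nonneg _)]
        congr 1; push_cast; ring
      simp only [h4] at h3
      simp only [hnorm]
      have hS : 0 ≤ ∑ j, b j ^ 2 * ‖z j‖ ^ r := Finset.sum_nonneg fun j _ => by positivity
      refine (Real.rpow_le_rpow (Finset.sum_nonneg fun j _ => by positivity) h3
        (by positivity : 0 ≤ r / 2)).trans_eq ?_
      rw [Real.mul_rpow (by positivity) (by positivity), ← Real.rpow_mul hB0, ← Real.rpow_mul hS,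
        inv_mul_cancel₀ (by positivity), Real.rpow_one, Finset.mul_sum, sub_mul, one_mul,
        inv_mul_cancel₀ (by positivity)]
      exact Finset.sum_congr rfl fun j _ => by ring

/-- Every infinite-dimensional `L^r` space admits arbitrarily many disjoint sets of positive
finite measure. -/
theorem exists_disjoint_sets [Fact (1 ≤ ENNReal.ofReal r)]
    (hinf : ¬ FiniteDimensional ℂ (Lp ℂ (ENNReal.ofReal r) μ)) (n : ℕ) :
    ∃ A : Fin n → Set Ω, (∀ i, MeasurableSet (A i)) ∧ (∀ i, μ (A i) ≠ 0) ∧ (∀ i, μ (A i) ≠ ⊤) ∧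
      Pairwise (fun i j => Disjoint (A i) (A j)) := by
  induction n with
  | zero => exact ⟨fun _ => ∅, fun i => i.elim0, fun i => i.elim0, fun i => i.elim0, fun i => i.elim0⟩
  | succ n ih =>
    obtain ⟨A, hAm, hA0, hAt, hAd⟩ := ih
    by_contra hno
    -- Otherwise `C` and the sets `A j \ C` would be `n + 1` admissible sets. So every `C` of
    -- positive finite measure contains some `A j` up to a null set.
    have hsplit : ∀ C : Set Ω, MeasurableSet C → μ C ≠ ⊤ → μ C ≠ 0 → ∃ j, μ (A j \ C) = 0 := by
      intro C hCm hCt hC0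
      by_contra! hj
      refine hno ⟨Fin.cons C fun j => A j \ C, ?_, ?_, ?_, ?_⟩
      · intro i
        refine Fin.cases ?_ (fun j => ?_) i
        · simpa using hCm
        · simpa using (hAm j).diff hCm
      · intro i
        refine Fin.cases ?_ (fun j => ?_) i
        · simpa using hC0
        · simpa using hj j
      · intro i
        refine Fin.cases ?_ (fun j => ?_) i
        · simpa using hCt
        · simpa using measure_ne_top_of_subset Set.sdiff_subset (hAt j)
      · intro i
        refine Fin.cases ?_ (fun i => ?_) i
        · intro j
          refine Fin.cases ?_ (fun j => ?_) j
          · simp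
          · intro _
            simpa using Set.disjoint_sdiff_right
        · intro j
          refine Fin.cases ?_ (fun j => ?_) j
          · intro _
            simpa using Set.disjoint_sdiff_left
          · intro hij
            have : i ≠ j := fun h => hij (by rw [h])
            simpa using (hAd this).mono Set.sdiff_subset Set.sdiff_subset
    refine hinf ?_
    set F : Fin n → Lp ℂ (ENNReal.ofReal r) μ :=
      fun i => indicatorConstLp _ (hAm i) (hAt i) (1 : ℂ) with hF
    -- The `A i` act as atoms: by `hsplit`, a set of finite measure agrees almost everywhere with a
    -- union of some of them. Its indicator lies in the span, which is closed because it is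
    -- finite-dimensional.
    have hspan : ∀ f : Lp ℂ (ENNReal.ofReal r) μ, f ∈ Submodule.span ℂ (Set.range F) := by
      refine Lp.induction ENNReal.ofReal_ne_top _ ?_ ?_ ?_
      · intro c B hBm hBt
        have hout : μ (B \ ⋃ i, A i) = 0 := by
          by_contra h0
          obtain ⟨j, hj⟩ := hsplit _ (hBm.diff (MeasurableSet.iUnion hAm))
            (measure_ne_top_of_subset Set.sdiff_subset hBt.ne) h0
          refine hA0 j ?_
          rwa [Disjoint.sdiff_eq_left] at hj
          exact Set.disjoint_sdiff_right.mono_left (Set.subset_iUnion A j)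
        have hin : ∀ i, μ (B ∩ A i) ≠ 0 → μ (A i \ B) = 0 := by
          intro i h0
          obtain ⟨j, hj⟩ := hsplit _ (hBm.inter (hAm i))
            (measure_ne_top_of_subset Set.inter_subset_left hBt.ne) h0
          rcases eq_or_ne j i with rfl | hji
          · rwa [Set.inter_comm, Set.sdiff_self_inter] at hj
          · refine absurd ?_ (hA0 j)
            rwa [Disjoint.sdiff_eq_left] at hj
            exact (hAd hji).mono_right Set.inter_subset_right
        classical
        have heq : (Lp.simpleFunc.indicatorConst (ENNReal.ofReal r) hBm hBt.ne c :
            Lp ℂ (ENNReal.ofReal r) μ) = ∑ i, (if μ (B ∩ A i) = 0 then 0 else c) • F i := by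
          rw [Lp.simpleFunc.coe_indicatorConst]
          refine Lp.ext ?_
          have h1 : ∀ᵐ ω ∂μ, ω ∉ B \ ⋃ i, A i := measure_eq_zero_iff_ae_notMem.1 hout
          have h2 : ∀ᵐ ω ∂μ, ∀ i, μ (B ∩ A i) ≠ 0 → ω ∉ A i \ B :=
            ae_all_iff.2 fun i => by
              by_cases h : μ (B ∩ A i) = 0
              · simp [h]
              · filter_upwards [measure_eq_zero_iff_ae_notMem.1 (hin i h)] with ω hω _ using hω
          have h3 : ∀ᵐ ω ∂μ, ∀ i, μ (B ∩ A i) = 0 → ω ∉ B ∩ A i :=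
            ae_all_iff.2 fun i => by
              by_cases h : μ (B ∩ A i) = 0
              · filter_upwards [measure_eq_zero_iff_ae_notMem.1 h] with ω hω _ using hω
              · simp [h]
          have h4 : ∀ᵐ ω ∂μ, ∀ i, F i ω = (A i).indicator (fun _ => (1 : ℂ)) ω :=
            ae_all_iff.2 fun i => indicatorConstLp_coeFn
          filter_upwards [h1, h2, h3, h4, coeFn_sum_smul Finset.univ
            (fun i => if μ (B ∩ A i) = 0 then 0 else c) F,
            (indicatorConstLp_coeFn : indicatorConstLp (ENNReal.ofReal r) hBm hBt.ne c =ᵐ[μ] _)]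
            with ω h1 h2 h3 h4 h5 h6
          rw [h5, h6]
          simp only [h4]
          by_cases hω : ∃ i, ω ∈ A i
          · obtain ⟨i, hi⟩ := hω
            have hother : ∀ j, j ≠ i → ω ∉ A j := fun j hj h =>
              Set.disjoint_left.1 (hAd hj) h hi
            rw [Finset.sum_eq_single i (fun j _ hj => by
              rw [Set.indicator_of_notMem (hother j hj), mul_zero]) (by simp)]
            rw [Set.indicator_of_mem hi, mul_one]
            split_ifs with h
            · exact Set.indicator_of_notMem (fun hB => h3 i h ⟨hB, hi⟩) _
            · have : ω ∈ B := by
                by_contra hB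
                exact h2 i h ⟨hi, hB⟩
              exact Set.indicator_of_mem this _
          · push Not at hω
            rw [Finset.sum_eq_zero fun i _ => by
              rw [Set.indicator_of_notMem (hω i), mul_zero]]
            refine Set.indicator_of_notMem (fun hB => h1 ⟨hB, ?_⟩) _
            simpa using hω
        rw [heq]
        exact Submodule.sum_mem _ fun i _ =>
          Submodule.smul_mem _ _ (Submodule.subset_span ⟨i, rfl⟩)
      · intro f g hf hg _ h1 h2
        exact Submodule.add_mem _ h1 h2
      · have : FiniteDimensional ℂ (Submodule.span ℂ (Set.range F)) :=
          FiniteDimensional.span_of_finite ℂ (Set.finite_range F)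
        exact (Submodule.span ℂ (Set.range F)).closed_of_finiteDimensional
    have htop : Submodule.span ℂ (Set.range F) = ⊤ := Submodule.eq_top_iff'.2 hspan
    exact Module.finite_def.2 (htop ▸ Submodule.fg_span (Set.finite_range F))

end LpSpace

/-! ### Copies of `ℓ^r_n` from disjoint sets. -/

section Systems

variable {Ω : Type*} [MeasurableSpace Ω] {μ : Measure Ω} {r : ℝ}

theorem norm_restrict_rpow (hr : 1 < r) [Fact (1 ≤ ENNReal.ofReal r)] (A : Set Ω)
    (x : Lp ℂ (ENNReal.ofReal r) μ) :
    ‖LpToLpRestrictCLM Ω ℂ ℂ μ (ENNReal.ofReal r) A x‖ ^ r = ∫ ω in A, ‖x ω‖ ^ r ∂μ := by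
  rw [norm_rpow_eq_integral hr]
  refine integral_congr_ae ?_
  filter_upwards [LpToLpRestrictCLM_coeFn ℂ A x] with ω hω
  rw [hω]

/-- An infinite-dimensional `L^r` contains complemented isometric copies of all `ℓ^r_n`. -/
theorem exists_isLpSystem (hr : 1 < r) [Fact (1 ≤ ENNReal.ofReal r)]
    (hinf : ¬ FiniteDimensional ℂ (Lp ℂ (ENNReal.ofReal r) μ)) (n : ℕ) :
    ∃ (f : Fin n → Lp ℂ (ENNReal.ofReal r) μ)
      (g : Fin n → StrongDual ℂ (Lp ℂ (ENNReal.ofReal r) μ)), IsLpSystem r 1 f g := by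
  have hr0 : 0 < r := by linarith
  obtain ⟨A, hAm, hA0, hAt, hAd⟩ := exists_disjoint_sets hinf n
  have hApos : ∀ i, 0 < μ.real (A i) := fun i => ENNReal.toReal_pos (hA0 i) (hAt i)
  set c : Fin n → ℂ := fun i => ((μ.real (A i) ^ (1 / r))⁻¹ : ℝ) with hc
  set f : Fin n → Lp ℂ (ENNReal.ofReal r) μ :=
    fun i => indicatorConstLp _ (hAm i) (hAt i) (c i) with hf
  have hfnorm : ∀ i, ‖f i‖ = 1 := fun i => by
    have hpos : 0 < μ.real (A i) ^ (1 / r) := Real.rpow_pos_of_pos (hApos i) _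
    rw [hf, norm_indicatorConstLp (by simp; linarith) ENNReal.ofReal_ne_top,
      ENNReal.toReal_ofReal hr0.le, hc, Complex.norm_real, Real.norm_eq_abs,
      abs_of_pos (inv_pos.2 hpos), inv_mul_cancel₀ hpos.ne']
  have hf_ae : ∀ᵐ ω ∂μ, ∀ i, f i ω = (A i).indicator (fun _ => c i) ω :=
    ae_all_iff.2 fun i => indicatorConstLp_coeFn
  set R := fun i => LpToLpRestrictCLM Ω ℂ ℂ μ (ENNReal.ofReal r) (A i) with hR
  have hRnorm : ∀ i, ‖R i (f i)‖ = 1 := fun i => by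
    have h1 : ‖R i (f i)‖ ^ r = 1 := by
      rw [hR, norm_restrict_rpow hr, setIntegral_eq_integral_of_ae_compl_eq_zero,
        ← norm_rpow_eq_integral hr, hfnorm, Real.one_rpow]
      filter_upwards [hf_ae] with ω hω hn
      rw [hω i, Set.indicator_of_notMem hn, norm_zero, Real.zero_rpow hr0.ne']
    rw [← rpow_rpow_one_div (norm_nonneg (R i (f i))) hr0.ne', h1, Real.one_rpow]
  -- The biorthogonal functional is a norming functional of the restriction of `f i` to `A i`,
  -- composed with that restriction. Disjointness of the `A i` then gives the bound on `∑ ‖g i x‖ ^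
  -- r`.
  choose h hh1 hh2 using fun i => exists_dual_vector'' ℂ (R i (f i))
  refine ⟨f, fun i => (h i).comp (R i), fun i => ?_, fun b => ?_, fun x => ?_⟩
  · rw [ContinuousLinearMap.comp_apply, hh2, hRnorm]; simp
  · rw [one_mul]
    have hS : 0 ≤ ∑ j, ‖b j‖ ^ r := Finset.sum_nonneg fun j _ => by positivity
    have key : ‖∑ j, b j • f j‖ ^ r ≤ ∑ j, ‖b j‖ ^ r := by
      have h1 : ∑ j, ‖b j‖ ^ r = ∑ j, ‖b j‖ ^ r * ‖f j‖ ^ r := by simp [hfnorm]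
      rw [h1]
      simp only [norm_rpow_eq_integral hr, ← integral_const_mul]
      rw [← integral_finsetSum _ fun i _ => (integrable_norm_rpow_Lp hr _).const_mul _]
      refine integral_mono_ae (integrable_norm_rpow_Lp hr _)
        (integrable_finsetSum _ fun i _ => (integrable_norm_rpow_Lp hr _).const_mul _) ?_
      filter_upwards [hf_ae, coeFn_sum_smul Finset.univ b f] with ω hω h2
      rw [h2]
      by_cases hx : ∃ i, ω ∈ A i
      · obtain ⟨i, hi⟩ := hx
        have hother : ∀ j, j ≠ i → f j ω = 0 := fun j hj => by
          rw [hω j, Set.indicator_of_notMem]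
          exact fun h => Set.disjoint_left.1 (hAd hj) h hi
        rw [Finset.sum_eq_single i (fun j _ hj => by rw [hother j hj, mul_zero]) (by simp),
          norm_mul, Real.mul_rpow (norm_nonneg _) (norm_nonneg _)]
        exact Finset.single_le_sum (f := fun j => ‖b j‖ ^ r * ‖f j ω‖ ^ r)
          (fun j _ => by positivity) (Finset.mem_univ i)
      · push Not at hx
        rw [Finset.sum_eq_zero fun i _ => by
          rw [hω i, Set.indicator_of_notMem (hx i), mul_zero], norm_zero, Real.zero_rpow hr0.ne']
        exact Finset.sum_nonneg fun j _ => by positivity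
    rw [← rpow_rpow_one_div (norm_nonneg (∑ j, b j • f j)) hr0.ne']
    exact Real.rpow_le_rpow (by positivity) key (by positivity)
  · calc ∑ i, ‖((h i).comp (R i)) x‖ ^ r ≤ ∑ i, ‖R i x‖ ^ r := by
          refine Finset.sum_le_sum fun i _ => Real.rpow_le_rpow (norm_nonneg _) ?_ hr0.le
          exact ((h i).le_opNorm _).trans (mul_le_of_le_one_left (norm_nonneg _) (hh1 i))
      _ = ∑ i, ∫ ω in A i, ‖x ω‖ ^ r ∂μ :=
          Finset.sum_congr rfl fun i _ => norm_restrict_rpow hr _ _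
      _ = ∫ ω in ⋃ i, A i, ‖x ω‖ ^ r ∂μ :=
          (integral_iUnion_fintype hAm hAd fun i => (integrable_norm_rpow_Lp hr x).integrableOn).symm
      _ ≤ ∫ ω, ‖x ω‖ ^ r ∂μ := setIntegral_le_integral (integrable_norm_rpow_Lp hr x)
          (Filter.Eventually.of_forall fun ω => by positivity)
      _ = ‖x‖ ^ r := (norm_rpow_eq_integral hr x).symm

end Systems

/-! ### Copies of `ℓ^2_n` from Rademacher sums. -/

section Rademacher

theorem sum_norm_sq_sum_sgn {n : ℕ} (c : Fin n → ℂ) :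
    ∑ ω : Fin n → Bool, ‖∑ j, (sgn (ω j) : ℂ) * c j‖ ^ 2 = 2 ^ n * ∑ i, ‖c i‖ ^ 2 := by
  have h : ∀ z : ℂ, ((‖z‖ ^ 2 : ℝ) : ℂ) = (starRingEnd ℂ) z * z := fun z => by
    rw [mul_comm, Complex.mul_conj, Complex.normSq_eq_norm_sq]
  have : ((∑ ω : Fin n → Bool, ‖∑ j, (sgn (ω j) : ℂ) * c j‖ ^ 2 : ℝ) : ℂ)
      = ((2 ^ n * ∑ i, ‖c i‖ ^ 2 : ℝ) : ℂ) := by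
    rw [Complex.ofReal_sum, Complex.ofReal_mul, Complex.ofReal_sum]
    simp only [h, Complex.ofReal_pow, Complex.ofReal_ofNat]
    calc _ = ∑ ω : Fin n → Bool, ∑ i, (starRingEnd ℂ) (c i) *
          ((sgn (ω i) : ℂ) * ∑ j, (sgn (ω j) : ℂ) * c j) := by
          refine Finset.sum_congr rfl fun ω _ => ?_
          rw [map_sum, Finset.sum_mul]
          refine Finset.sum_congr rfl fun i _ => ?_
          rw [map_mul, Complex.conj_ofReal]
          ring
      _ = ∑ i, (starRingEnd ℂ) (c i) * (2 ^ n * c i) := by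
          rw [Finset.sum_comm]
          refine Finset.sum_congr rfl fun i _ => ?_
          rw [← Finset.mul_sum, sum_sgn_mul_sum]
      _ = _ := by
          rw [Finset.mul_sum]
          exact Finset.sum_congr rfl fun i _ => by ring
  exact_mod_cast this

/-- Bessel's inequality for the coordinate signs. -/
theorem sum_norm_sq_avg_le {n : ℕ} (y : (Fin n → Bool) → ℂ) :
    ∑ i, ‖(∑ ω : Fin n → Bool, (sgn (ω i) : ℂ) * y ω) / 2 ^ n‖ ^ 2
      ≤ (∑ ω, ‖y ω‖ ^ 2) / 2 ^ n := by
  set c : Fin n → ℂ := fun i => (∑ ω : Fin n → Bool, (sgn (ω i) : ℂ) * y ω) / 2 ^ n with hc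
  set S : (Fin n → Bool) → ℂ := fun ω => ∑ j, (sgn (ω j) : ℂ) * c j with hS
  have h1 : ∑ ω, ‖S ω‖ ^ 2 = 2 ^ n * ∑ i, ‖c i‖ ^ 2 := sum_norm_sq_sum_sgn c
  have h2 : ((2 ^ n * ∑ i, ‖c i‖ ^ 2 : ℝ) : ℂ) = ∑ ω, (starRingEnd ℂ) (S ω) * y ω := by
    have hci : ∀ i, ∑ ω : Fin n → Bool, (sgn (ω i) : ℂ) * y ω = 2 ^ n * c i := fun i => by
      simp only [hc]; field_simp
    simp only [hS, map_sum, map_mul, Complex.conj_ofReal, Finset.sum_mul]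
    rw [Finset.sum_comm, Finset.mul_sum, Complex.ofReal_sum]
    refine Finset.sum_congr rfl fun i _ => ?_
    have : ∀ ω : Fin n → Bool, (sgn (ω i) : ℂ) * (starRingEnd ℂ) (c i) * y ω
        = (starRingEnd ℂ) (c i) * ((sgn (ω i) : ℂ) * y ω) := fun ω => by ring
    simp only [this]
    rw [← Finset.mul_sum, hci, Complex.ofReal_mul, Complex.ofReal_pow, Complex.ofReal_pow,
      Complex.ofReal_ofNat, ← Complex.ofReal_pow, ← Complex.normSq_eq_norm_sq, ← Complex.mul_conj]
    ring
  -- With `h2`, the left side is the pairing of `y` with its projection `S`. Bounding the pairing by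
  -- `(‖S‖² + ‖y‖²) / 2` and inserting `h1` absorbs half of it.
  have h3 : 2 ^ n * ∑ i, ‖c i‖ ^ 2 ≤ ∑ ω, (‖S ω‖ ^ 2 + ‖y ω‖ ^ 2) / 2 := by
    have h4 : ‖((2 ^ n * ∑ i, ‖c i‖ ^ 2 : ℝ) : ℂ)‖ = 2 ^ n * ∑ i, ‖c i‖ ^ 2 := by
      rw [Complex.norm_real, Real.norm_eq_abs, abs_of_nonneg]
      exact mul_nonneg (by positivity) (Finset.sum_nonneg fun i _ => by positivity)
    rw [← h4, h2]
    refine (norm_sum_le _ _).trans (Finset.sum_le_sum fun ω _ => ?_)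
    rw [norm_mul, RCLike.norm_conj]
    have := two_mul_le_add_sq ‖S ω‖ ‖y ω‖
    linarith
  rw [← Finset.sum_div, Finset.sum_add_distrib, h1] at h3
  rw [le_div_iff₀ (by positivity)]
  linarith

variable {E : Type*} [NormedAddCommGroup E] [NormedSpace ℂ E]

/-- With constant `1`, the term `g j (f j) = 1` already exhausts the bound `∑ₖ ‖gₖ (f j)‖ ^ r ≤ 1`.
-/
theorem IsLpSystem.apply_of_ne {r : ℝ} (hr : 0 < r) {n : ℕ} {f : Fin n → E}
    {g : Fin n → StrongDual ℂ E} (h : IsLpSystem r 1 f g) {i j : Fin n} (hij : i ≠ j) :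
    g i (f j) = 0 := by
  have h1 : ‖f j‖ ≤ 1 := by
    have := h.norm_sum_le (Pi.single j 1)
    rw [Finset.sum_eq_single j (by intro k _ hk; simp [hk]) (by simp),
      Finset.sum_eq_single j (by intro k _ hk; simp [hk, Real.zero_rpow hr.ne']) (by simp)] at this
    simpa using this
  have h2 := (h.sum_le (f j)).trans (Real.rpow_le_one (norm_nonneg _) h1 hr.le)
  have h3 := Finset.add_le_sum (f := fun k => ‖g k (f j)‖ ^ r) (s := Finset.univ)
    (fun k _ => by positivity) (Finset.mem_univ i) (Finset.mem_univ j) hij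
  have h4 : ‖g i (f j)‖ ^ r ≤ 0 := by
    have := h3.trans h2
    simp only [h.apply_self, norm_one, Real.one_rpow] at this
    linarith
  have h5 := (Real.rpow_eq_zero (norm_nonneg (g i (f j))) hr.ne').1
    (le_antisymm h4 (by positivity))
  exact norm_eq_zero.1 h5

/-- For `r ≥ 2`, Rademacher sums produce copies of `ℓ^2_n` in spaces that contain `ℓ^r_N` for
all `N`. -/
theorem exists_isLpSystem_two {r : ℝ} (hr : 2 ≤ r) :
    ∃ K : ℝ, 0 < K ∧ ((∀ n : ℕ, ∃ (f : Fin n → E) (g : Fin n → StrongDual ℂ E),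
      IsLpSystem r 1 f g) → ∀ n : ℕ, ∃ (f : Fin n → E) (g : Fin n → StrongDual ℂ E),
      IsLpSystem 2 K f g) := by
  have hr0 : 0 < r := by linarith
  obtain ⟨A, hA, hkh⟩ := khinchine hr0
  refine ⟨A ^ (1 / r), by positivity, fun hsys n => ?_⟩
  obtain ⟨F, G, h⟩ := hsys (Fintype.card (Fin n → Bool))
  set e := Fintype.equivFin (Fin n → Bool) with he
  have hpair : ∀ ω ω', G (e ω) (F (e ω')) = if ω = ω' then 1 else 0 := fun ω ω' => by
    split_ifs with hω
    · rw [hω, h.apply_self]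
    · exact h.apply_of_ne hr0 fun h' => hω (e.injective h')
  -- The factor `a` turns the `ℓ^r` norm on `2^n` coordinates into an average over signs.
  -- Khinchine's inequality then bounds the sums of `f`, and Bessel's inequality with `2 ≤ r` bounds
  -- the functionals.
  set a : ℝ := ((2 : ℝ) ^ n) ^ (1 / r) with ha
  have ha0 : 0 < a := by positivity
  have har : a ^ r = 2 ^ n := rpow_one_div_rpow (by positivity) hr0.ne'
  have hac : (a : ℂ) ≠ 0 := by exact_mod_cast ha0.ne'
  refine ⟨fun i => ∑ ω : Fin n → Bool, ((a : ℂ)⁻¹ * (sgn (ω i) : ℂ)) • F (e ω),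
    fun i => ∑ ω : Fin n → Bool, ((a : ℂ) * (sgn (ω i) : ℂ) / 2 ^ n) • G (e ω),
    fun i => ?_, fun b => ?_, fun x => ?_⟩
  · simp only [sum_apply, smul_apply, map_sum, map_smul, hpair, smul_eq_mul, mul_ite, mul_one,
      mul_zero]
    have : ∀ ω : Fin n → Bool, (a : ℂ)⁻¹ * (sgn (ω i) : ℂ) * ((a : ℂ) * (sgn (ω i) : ℂ) / 2 ^ n)
        = (2 ^ n)⁻¹ := fun ω => by
      have h1 : (sgn (ω i) : ℂ) * (sgn (ω i) : ℂ) = 1 := by exact_mod_cast sgn_mul_self (ω i)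
      calc _ = ((a : ℂ) * (a : ℂ)⁻¹) * ((sgn (ω i) : ℂ) * (sgn (ω i) : ℂ)) * (2 ^ n)⁻¹ := by ring
        _ = _ := by rw [h1, mul_inv_cancel₀ hac, one_mul, one_mul]
    simp [this]
  · have h1 : ∑ j, b j • ∑ ω : Fin n → Bool, ((a : ℂ)⁻¹ * (sgn (ω j) : ℂ)) • F (e ω)
        = ∑ k, ((a : ℂ)⁻¹ * ∑ j, (sgn (e.symm k j) : ℂ) * b j) • F k := by
      rw [← Equiv.sum_comp e]
      simp only [Equiv.symm_apply_apply, Finset.smul_sum, Finset.mul_sum, Finset.sum_smul]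
      rw [Finset.sum_comm]
      refine Finset.sum_congr rfl fun ω _ => Finset.sum_congr rfl fun j _ => ?_
      rw [smul_smul]
      congr 1
      ring
    rw [h1]
    refine (h.norm_sum_le _).trans ?_
    rw [one_mul, ← Equiv.sum_comp e]
    simp only [Equiv.symm_apply_apply, norm_mul, norm_inv, Complex.norm_real, Real.norm_eq_abs,
      abs_of_pos ha0]
    have h2 : ∀ ω : Fin n → Bool, (a⁻¹ * ‖∑ j, (sgn (ω j) : ℂ) * b j‖) ^ r
        = ‖∑ j, (sgn (ω j) : ℂ) * b j‖ ^ r / 2 ^ n := fun ω => by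
      rw [Real.mul_rpow (by positivity) (norm_nonneg _), Real.inv_rpow ha0.le, har, div_eq_inv_mul]
    simp only [h2, Real.rpow_two]
    rw [← Finset.sum_div]
    have hB : 0 ≤ ∑ j, ‖b j‖ ^ 2 := Finset.sum_nonneg fun j _ => by positivity
    refine (Real.rpow_le_rpow (div_nonneg (Finset.sum_nonneg fun ω _ => by positivity)
      (by positivity)) (hkh n b) (by positivity)).trans_eq ?_
    rw [Real.mul_rpow hA.le (by positivity), ← Real.rpow_mul hB]
    congr 2
    field_simp
  · simp only [Real.rpow_two]
    have h1 : ∀ i, (∑ ω : Fin n → Bool, ((a : ℂ) * (sgn (ω i) : ℂ) / 2 ^ n) • G (e ω)) x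
        = (∑ ω : Fin n → Bool, (sgn (ω i) : ℂ) * ((a : ℂ) * G (e ω) x)) / 2 ^ n := fun i => by
      rw [sum_apply, Finset.sum_div]
      refine Finset.sum_congr rfl fun ω _ => ?_
      rw [smul_apply, smul_eq_mul]
      ring
    simp only [h1]
    refine (sum_norm_sq_avg_le _).trans ?_
    have h2 := avg_rpow_le_rpow two_pos hr (fun ω : Fin n → Bool => ‖(a : ℂ) * G (e ω) x‖)
      fun ω => norm_nonneg _
    simp only [Real.rpow_two] at h2
    refine h2.trans ?_
    have h3 : (∑ ω : Fin n → Bool, ‖(a : ℂ) * G (e ω) x‖ ^ r) / 2 ^ n = ∑ k, ‖G k x‖ ^ r := by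
      rw [← Equiv.sum_comp e, Finset.sum_div]
      refine Finset.sum_congr rfl fun ω _ => ?_
      rw [norm_mul, Complex.norm_real, Real.norm_eq_abs, abs_of_pos ha0,
        Real.mul_rpow ha0.le (norm_nonneg _), har]
      field_simp
    rw [h3]
    refine (Real.rpow_le_rpow (Finset.sum_nonneg fun k _ => by positivity) (h.sum_le x)
      (by positivity)).trans_eq ?_
    rw [← Real.rpow_mul (norm_nonneg _), mul_div_cancel₀ _ hr0.ne', Real.rpow_two]

end Rademacher

/-! ### Growth exponents along the curves `𝒟_c`. -/

theorem rBar_pos {r : ℝ} (hr : 1 < r) : 0 < rBar r := lt_min two_pos (by linarith)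

theorem one_div_le_one_div_rBar {r : ℝ} (hr : 1 < r) : 1 / r ≤ 1 / rBar r :=
  one_div_le_one_div_of_le (rBar_pos hr) (min_le_right _ _)

theorem curveD_subset_triangle {r c : ℝ} (hr : 1 < r) : curveD r c ⊆ triangle := by
  intro P hP
  unfold curveD at hP
  split_ifs at hP with h1 h2
  · exact hP.1
  · rcases hP with hP | hP
    · exact hP.1.1
    · exact ⟨hr.le.trans hP.1.1, hP.1.2.trans hP.2.ge⟩
  · rcases hP with hP | hP
    · exact hP.1.1
    · refine ⟨one_le_two.trans hP.1.1, (hP.1.2.trans ?_).trans hP.2.ge⟩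
      have hb : rBar r = 2 := by
        rcases min_choice 2 r with h | h
        · exact h
        · rw [rBar, h] at h1
          exact absurd h1 (by simpa using h2)
      rw [hb, not_le] at h1
      have hv : 0 < vCoord c := div_pos two_pos (by linarith)
      rw [wCoord, div_le_iff₀ (by linarith)]
      nlinarith

/-- For `p ≤ r` the maximum in `growth` is `1/p - 1/r` and the defining equation of `𝒞_c` applies;
for `p ≥ r` it is `0`, and `1/u_c = 1/r - c`. -/
theorem growth_of_lt_one_div {r c : ℝ} (hr : 1 < r) (hc : c < 1 / r) {P : ℝ × ℝ}
    (hP : P ∈ curveD r c) : growth r P = 1 / r - c := by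
  have hr0 : 0 < r := by linarith
  unfold curveD at hP
  rw [if_neg (not_le.2 (hc.trans_le (one_div_le_one_div_rBar hr))), if_pos hc] at hP
  rcases hP with ⟨⟨-, hP⟩, h1, h2⟩ | ⟨⟨h1, -⟩, h2⟩
  · rw [growth, max_eq_right]
    · linarith
    · exact sub_nonneg.2 (one_div_le_one_div_of_le (by linarith) h2)
  · rw [growth, max_eq_left (sub_nonpos.2 (one_div_le_one_div_of_le hr0 h1)), h2, uCoord]
    rw [lt_div_iff₀ hr0] at hc
    field_simp
    ring

theorem growth_nonpos_of_le {s : ℝ} {P : ℝ × ℝ} (h : 1 / s ≤ 1 / P.1 - 1 / P.2) :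
    growth s P ≤ 0 := by
  have := le_max_right 0 (1 / P.1 - 1 / s)
  rw [growth]
  linarith

theorem growth_nonpos_of_one_div_le {r c : ℝ} (hr : 1 < r) (hc : 1 / r ≤ c) {P : ℝ × ℝ}
    (hP : P ∈ curveD r c) : growth r P ≤ 0 := by
  have hr0 : 0 < r := by linarith
  refine growth_nonpos_of_le ?_
  unfold curveD at hP
  split_ifs at hP with h1 h2
  · rw [hP.2]; exact hc
  · exact absurd hc (not_le.2 h2)
  · rcases hP with ⟨hP, -⟩ | ⟨⟨h3, h4⟩, h5⟩
    · rw [hP.2]; exact hc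
    · have hb : rBar r = 2 := by
        rcases min_choice 2 r with h | h
        · exact h
        · rw [rBar, h] at h1
          exact absurd hc h1
      rw [hb, not_le] at h1
      have hv : 0 < vCoord c := div_pos two_pos (by linarith)
      have hp0 : 0 < P.1 := by linarith
      have := one_div_le_one_div_of_le hp0 h4
      rw [h5]
      -- The horizontal segment ends on `𝒞_{1/r}`, so `1/p - 1/q ≥ 1/r` along it.
      have e : 1 / wCoord r c = 1 / r + 1 / vCoord c := by
        rw [wCoord]; field_simp; ring
      linarith

theorem growth_two_of_lt {r c : ℝ} (hr : 2 ≤ r) (hc : 1 / r ≤ c) (hc2 : c < 1 / 2) {P : ℝ × ℝ}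
    (hP : P ∈ curveD r c) : growth 2 P = 1 / 2 - c := by
  have hb : rBar r = 2 := min_eq_left hr
  unfold curveD at hP
  rw [hb, if_neg (not_le.2 hc2), if_neg (not_lt.2 hc)] at hP
  rcases hP with ⟨⟨⟨h0, -⟩, hP⟩, h1, h2⟩ | ⟨⟨h1, -⟩, h2⟩
  · rw [growth, max_eq_right]
    · linarith
    · exact sub_nonneg.2 (one_div_le_one_div_of_le (by linarith) h2)
  · rw [growth, max_eq_left (sub_nonpos.2 (one_div_le_one_div_of_le two_pos h1)), h2, vCoord]
    field_simp
    ring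

theorem one_div_sub_of_rBar_le {r c : ℝ} (hc : 1 / rBar r ≤ c) {P : ℝ × ℝ}
    (hP : P ∈ curveD r c) : 1 / P.1 - 1 / P.2 = c := by
  rw [curveD, if_pos hc] at hP
  exact hP.2

/-! ### Domination between multi-norms, and assembly. -/

section

variable {E : Type*}

theorem Dominates.trans {N₁ N₂ N₃ : ∀ n : ℕ, (Fin n → E) → ℝ} (h₁ : Dominates N₁ N₂)
    (h₂ : Dominates N₂ N₃) : Dominates N₁ N₃ := by
  obtain ⟨C, hC, h⟩ := h₁
  obtain ⟨D, hD, h'⟩ := h₂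
  refine ⟨D * C, mul_pos hD hC, fun n x => (h' n x).trans ?_⟩
  rw [mul_assoc]
  exact mul_le_mul_of_nonneg_left (h n x) hD.le

theorem Equivalent.symm {N₁ N₂ : ∀ n : ℕ, (Fin n → E) → ℝ} (h : Equivalent N₁ N₂) :
    Equivalent N₂ N₁ := ⟨h.2, h.1⟩

theorem Equivalent.trans {N₁ N₂ N₃ : ∀ n : ℕ, (Fin n → E) → ℝ} (h₁ : Equivalent N₁ N₂)
    (h₂ : Equivalent N₂ N₃) : Equivalent N₁ N₃ := ⟨h₁.1.trans h₂.1, h₂.2.trans h₁.2⟩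

end

section

variable {E : Type*} [NormedAddCommGroup E] [NormedSpace ℂ E]

/-- If `E` contains complemented copies of the spaces `ℓ^r_n`, and also of `ℓ^2_n` when `r > 2`,
then points on curves with different parameters are not equivalent. -/
theorem not_dominates_of_lt {r : ℝ} (hr : 1 < r) {K : ℝ} (hK : 0 < K)
    (hsys : ∀ n : ℕ, ∃ (f : Fin n → E) (g : Fin n → StrongDual ℂ E), IsLpSystem r 1 f g)
    (hsys2 : 2 ≤ r → ∀ n : ℕ, ∃ (f : Fin n → E) (g : Fin n → StrongDual ℂ E),
      IsLpSystem 2 K f g)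
    {c₁ c₂ : ℝ} (h12 : c₁ < c₂) (h1 : c₁ < 1 / rBar r)
    {P₁ P₂ : ℝ × ℝ} (hP₁ : P₁ ∈ curveD r c₁) (hP₂ : P₂ ∈ curveD r c₂) :
    ¬ Dominates (pqNorm (E := E) P₂.1 P₂.2) (pqNorm (E := E) P₁.1 P₁.2) := by
  have ht₁ := curveD_subset_triangle hr hP₁
  have ht₂ := curveD_subset_triangle hr hP₂
  rcases lt_or_ge c₁ (1 / r) with h | h
  · refine not_dominates_of_growth_lt (by linarith) one_pos hsys ht₁ ht₂ ?_
    rw [growth_of_lt_one_div hr h hP₁]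
    refine max_lt (by linarith) ?_
    rcases lt_or_ge c₂ (1 / r) with h' | h'
    · rw [growth_of_lt_one_div hr h' hP₂]; linarith
    · exact (growth_nonpos_of_one_div_le hr h' hP₂).trans_lt (by linarith)
  -- The growth on `ℓ^r` systems is nonpositive here and separates nothing, so the `ℓ^2` systems are
  -- used.
  · have hr2 : 2 ≤ r := by
      by_contra hlt
      rw [rBar, min_eq_right (not_le.1 hlt).le] at h1
      linarith
    have hb : rBar r = 2 := min_eq_left hr2
    rw [hb] at h1
    refine not_dominates_of_growth_lt two_pos hK (hsys2 hr2) ht₁ ht₂ ?_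
    rw [growth_two_of_lt hr2 h h1 hP₁]
    refine max_lt (by linarith) ?_
    rcases lt_or_ge c₂ (1 / 2) with h' | h'
    · rw [growth_two_of_lt hr2 (by linarith) h' hP₂]; linarith
    · refine (growth_nonpos_of_le ?_).trans_lt (sub_pos.2 h1)
      rw [one_div_sub_of_rBar_le (by rwa [hb]) hP₂]; exact h'

theorem dominates_pqNorm_minNorm {P : ℝ × ℝ} (hP : P ∈ triangle) :
    Dominates (pqNorm (E := E) P.1 P.2) (minNorm (E := E)) := by
  refine ⟨1, one_pos, fun n x => ?_⟩
  rw [one_mul]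
  -- For `n = 0` the real supremum over the empty index type is `0`, hence the nonnegativity
  -- argument.
  exact Real.iSup_le (fun i => norm_le_pqNorm hP.1 hP.2 x i) (pqNorm_nonneg x)

/-- If bounded tuples in `E` have type `s`, then the `(p,q)`-multi-norm
is dominated by the minimum multi-norm as soon as `1/p - 1/q ≥ 1/s`. -/
theorem dominates_minNorm_pqNorm {r s A : ℝ} (hs : 0 < s) (hsr : s ≤ r) (hA : 0 < A)
    (htype : ∀ (n : ℕ) (x : Fin n → E) (M : ℝ), 0 ≤ M → (∀ i, ‖x i‖ ≤ M) →
      ∀ b : Fin n → ℝ, (∀ i, 0 ≤ b i) →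
      (∑ ω : Fin n → Bool, ‖∑ j, (sgn (ω j) : ℂ) • (b j : ℂ) • x j‖ ^ r) / 2 ^ n
        ≤ A * M ^ r * (∑ j, b j ^ s) ^ (r / s))
    {P : ℝ × ℝ} (hP : P ∈ triangle) (hPs : 1 / s ≤ 1 / P.1 - 1 / P.2) :
    Dominates (minNorm (E := E)) (pqNorm (E := E) P.1 P.2) := by
  obtain ⟨p, q⟩ := P
  obtain ⟨hp, hpq⟩ := hP
  dsimp only at hp hpq hPs ⊢
  have hp0 : 0 < p := by linarith
  have hq0 : 0 < q := by linarith
  have hr0 : 0 < r := by linarith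
  have hps : p < s := by
    have h1 : 0 < 1 / q := by positivity
    exact (one_div_lt_one_div hs hp0).1 (by linarith)
  set t := 1 / (1 / p - 1 / s) with ht
  have hinv : 0 < 1 / p - 1 / s := sub_pos.2 (one_div_lt_one_div_of_lt hp0 hps)
  have ht0 : 0 < t := by positivity
  have hts : 1 / t = 1 / p - 1 / s := by rw [ht, one_div_one_div]
  -- This is where `1/p - 1/q ≥ 1/s` enters: passing from `ℓ^t` to `ℓ^q` costs no power of `n`.
  have htq : t ≤ q := (one_div_le_one_div hq0 ht0).1 (by rw [hts]; linarith)
  set K := A ^ (1 / r) with hK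
  have hK0 : 0 < K := by positivity
  have hKr : K ^ r = A := rpow_one_div_rpow hA.le hr0.ne'
  refine ⟨K, hK0, fun n x => ?_⟩
  set M := minNorm n x with hM
  have hM0 : 0 ≤ M := Real.iSup_nonneg fun i => norm_nonneg _
  have hxM : ∀ i, ‖x i‖ ≤ M := fun i => le_ciSup (f := fun i => ‖x i‖) (Set.finite_range _).bddAbove i
  have hKM : 0 ≤ K * M := by positivity
  refine pqNorm_le hKM x fun l hl => ?_
  have hdiag : ∑ i, ‖l i (x i)‖ ^ t ≤ (K * M) ^ t := by
    refine sum_diagonal_rpow_le hp hps ht0 hts hKM hl x fun b hb => ?_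
    have hB : 0 ≤ ∑ j, b j ^ s := Finset.sum_nonneg fun j _ => Real.rpow_nonneg (hb j) _
    -- The type estimate is in the `r`-th moment, and `p < s ≤ r`.
    refine (avg_rpow_le_rpow hp0 (hps.le.trans hsr) _ fun ω => norm_nonneg _).trans ?_
    have h1 := htype n x M hM0 hxM b hb
    have e : A * M ^ r * (∑ j, b j ^ s) ^ (r / s) = (K * M * (∑ j, b j ^ s) ^ (1 / s)) ^ r := by
      rw [Real.mul_rpow hKM (by positivity), Real.mul_rpow hK0.le hM0, hKr,
        ← Real.rpow_mul hB]
      congr 2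
      ring
    rw [e] at h1
    refine (Real.rpow_le_rpow (div_nonneg (Finset.sum_nonneg fun ω _ => by positivity)
      (by positivity)) h1 (by positivity)).trans_eq ?_
    rw [← Real.rpow_mul (by positivity), mul_div_cancel₀ _ hr0.ne']
  rcases hKM.eq_or_lt with h0 | hpos
  · have hM' : M = 0 := by
      rcases mul_eq_zero.1 h0.symm with h | h
      · exact absurd h hK0.ne'
      · exact h
    have hx0 : ∀ i, x i = 0 := fun i => norm_le_zero_iff.1 ((hxM i).trans_eq hM')
    simp [hx0, Real.zero_rpow hq0.ne', Real.zero_rpow (inv_pos.2 hq0).ne', ← h0]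
  · have h1 : ∑ i, (‖l i (x i)‖ / (K * M)) ^ t ≤ 1 := by
      simp only [Real.div_rpow (norm_nonneg _) hKM]
      rw [← Finset.sum_div, div_le_one (by positivity)]
      exact hdiag
    have h2 := sum_rpow_le_one_of_le (fun i => by positivity) ht0 htq h1
    simp only [Real.div_rpow (norm_nonneg _) hKM] at h2
    rw [← Finset.sum_div, div_le_one (by positivity)] at h2
    calc _ ≤ ((K * M) ^ q) ^ (1 / q) := Real.rpow_le_rpow
          (Finset.sum_nonneg fun i _ => by positivity) h2 (by positivity)
      _ = K * M := rpow_rpow_one_div hKM hq0.ne'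

end

end MultiNormed

theorem mainTheorem3 {Ω : Type*} [MeasurableSpace Ω] (μ : Measure Ω)
    (r : ℝ) (hr : 1 < r) [Fact (1 ≤ ENNReal.ofReal r)]
    (hinf : ¬ FiniteDimensional ℂ (Lp ℂ (ENNReal.ofReal r) μ))
    (c₁ c₂ : ℝ) (hc₁ : c₁ ∈ Set.Ico (0 : ℝ) 1) (hc₂ : c₂ ∈ Set.Ico (0 : ℝ) 1)
    (P₁ P₂ : ℝ × ℝ) (hP₁ : P₁ ∈ MultiNormed.curveD r c₁) (hP₂ : P₂ ∈ MultiNormed.curveD r c₂) :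
    (1 / MultiNormed.rBar r ≤ c₁ → 1 / MultiNormed.rBar r ≤ c₂ →
      MultiNormed.PointsEquivalent (Lp ℂ (ENNReal.ofReal r) μ) P₁ P₂ ∧
      MultiNormed.EquivalentToMin (Lp ℂ (ENNReal.ofReal r) μ) P₁ ∧
      MultiNormed.EquivalentToMin (Lp ℂ (ENNReal.ofReal r) μ) P₂) ∧
    (1 / MultiNormed.rBar r ≤ c₁ → c₂ < 1 / MultiNormed.rBar r →
      ¬ MultiNormed.PointsEquivalent (Lp ℂ (ENNReal.ofReal r) μ) P₁ P₂) ∧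
    (c₁ < 1 / MultiNormed.rBar r → c₂ < 1 / MultiNormed.rBar r → c₁ ≠ c₂ →
      ¬ MultiNormed.PointsEquivalent (Lp ℂ (ENNReal.ofReal r) μ) P₁ P₂) := by
  set E := Lp ℂ (ENNReal.ofReal r) μ
  have ht₁ := MultiNormed.curveD_subset_triangle hr hP₁
  have ht₂ := MultiNormed.curveD_subset_triangle hr hP₂
  have hmin : ∀ {c : ℝ} {P : ℝ × ℝ}, 1 / MultiNormed.rBar r ≤ c → P ∈ MultiNormed.curveD r c →
      MultiNormed.EquivalentToMin E P := by
    intro c P hc hP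
    obtain ⟨A, hA, htype⟩ := MultiNormed.exists_type_const μ hr
    refine ⟨MultiNormed.dominates_pqNorm_minNorm (MultiNormed.curveD_subset_triangle hr hP),
      MultiNormed.dominates_minNorm_pqNorm (MultiNormed.rBar_pos hr) (min_le_right 2 r) hA htype
        (MultiNormed.curveD_subset_triangle hr hP) ?_⟩
    rw [MultiNormed.one_div_sub_of_rBar_le hc hP]
    exact hc
  have hne : ∀ {c c' : ℝ} {P P' : ℝ × ℝ}, c < c' → c < 1 / MultiNormed.rBar r →
      P ∈ MultiNormed.curveD r c → P' ∈ MultiNormed.curveD r c' →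
      ¬ MultiNormed.Dominates (MultiNormed.pqNorm (E := E) P'.1 P'.2)
        (MultiNormed.pqNorm (E := E) P.1 P.2) := by
    intro c c' P P' hcc hc hP hP'
    have hsys := MultiNormed.exists_isLpSystem hr hinf
    rcases le_or_gt 2 r with h2 | h2
    · obtain ⟨K, hK, hsys2⟩ := MultiNormed.exists_isLpSystem_two (E := E) h2
      exact MultiNormed.not_dominates_of_lt hr hK hsys (fun _ => hsys2 hsys) hcc hc hP hP'
    -- For `r < 2` the `ℓ^r` systems suffice; the constant for `ℓ^2` systems is irrelevant.
    · exact MultiNormed.not_dominates_of_lt hr one_pos hsys (fun h => absurd h (not_le.2 h2))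
        hcc hc hP hP'
  refine ⟨fun h₁ h₂ => ⟨?_, hmin h₁ hP₁, hmin h₂ hP₂⟩, fun h₁ h₂ h => ?_, fun h₁ h₂ hc h => ?_⟩
  · exact (hmin h₁ hP₁).trans (hmin h₂ hP₂).symm
  -- Only one direction of the equivalence fails: the curve with the larger parameter cannot
  -- dominate the one with the smaller.
  · exact hne (h₂.trans_le h₁) h₂ hP₂ hP₁ h.1
  · rcases hc.lt_or_gt with hlt | hlt
    · exact hne hlt h₁ hP₁ hP₂ h.2
    · exact hne hlt h₂ hP₂ hP₁ h.1
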